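/- A double poset $D$ on a finite set $N$ with $n$ elements consists of two partial orders $\le_1,\le_2$ on $N$; write $\prec_1$ for the covering relation of $\le_1$. A pair $(a,b)$ is an inversion if $a<_1b$ and $b<_2a$, and a descent if moreover $a\prec_1 b$. $D$ is inversion-reducible if for every inversion $(a,b)$ either $(a,b)$ is a descent or there is $c$ with $a<_1c<_1b$ such that $(a,c)$ or $(c,b)$ is an inversion. A $D$-partition is a function $f:N\to\mathbb N$ with $f(i)\le f(j)$ whenever $i\le_1 j$, and $f(i)<f(j)$ whenever $i<_1j$ and $j<_2i$. A mixed graph $G=(V,U,E)$ on a finite set $V$ has a set $U$ of undirected edges and a set $E$ of directed edges. A weak coloring is a function $f:V\to\mathbb N$ with $f(u)\ne f(v)$ for $uv\in U$ and $f(u)\le f(v)$ for $(u,v)\in E$. A mixed cycle is a cyclic sequence of at least three distinct vertices, together with, for each pair of consecutive vertices, an edge of $G$ joining them, which is either undirected or directed from the first to the second, at least one of these edges being directed. Let $m(G)$ be the minimum number of undirected edges on a mixed cycle of $G$, and $m(G)=|V|$ if $G$ has no mixed cycle. The mixed graph $G(D)$ has vertex set $N$, directed edges $(u,v)$ for all $u\prec_1v$,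 and undirected edges $uv$ for all $u\prec_1v$ with $v\le_2u$. Put $m(D)=m(G(D))$. If a finite group $\mathfrak G$ acts on $N$, it acts on functions $f:N\to\mathbb N$ by $(\mathfrak g f)(v)=f(\mathfrak g^{-1}v)$. For $\mathfrak g\in\mathfrak G$ put $\mathbf x^f=\prod_{v}x_{f(v)}$, $\Omega(D,\mathfrak G,\mathbf x;\mathfrak g)=\sum_f\mathbf x^f$ over all $D$-partitions $f$ with $\mathfrak gf=f$, and $\chi(G,\mathfrak G,\mathbf x;\mathfrak g)=\sum_f\mathbf x^f$ over all weak colorings $f$ of $G$ with $\mathfrak gf=f$. For $S=\{s_1<\dots<s_k\}\subseteq[n-1]$ let $M_{S,n}=\sum_{i_1<\dots<i_{k+1}}\prod_{j=1}^{k+1}x_{i_j}^{s_j-s_{j-1}}$ with $s_0=0$, $s_{k+1}=n$ (and $M_{\emptyset,0}=1$), and let $F_{S,n}=\sum_{S\subseteq T\subseteq[n-1]}M_{T,n}$. Theorem. Let $D$ be an inversion-reducible double poset on $n$ elements, and let a finite group $\mathfrak G$ act on $D$, that is, on $N$ by automorphisms of both orders. Then $\mathfrak G$ acts on $G(D)$,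 that is, every $\mathfrak g\in\mathfrak G$ preserves the undirected and the directed edges of $G(D)$, and $$\Omega(D,\mathfrak G,\mathbf x)=\chi(G(D),\mathfrak G,\mathbf x).$$ Moreover, there are unique functions $[F_{S,n}]\Omega(D,\mathfrak G,\mathbf x):\mathfrak G\to\mathbb C$, for $S\subseteq[n-1]$, with $$\Omega(D,\mathfrak G,\mathbf x;\mathfrak g)=\sum_{S\subseteq[n-1]}[F_{S,n}]\Omega(D,\mathfrak G,\mathbf x)(\mathfrak g)\,F_{S,n}\quad\text{for all }\mathfrak g\in\mathfrak G,$$ and for every $S\subseteq[n-1]$ with $|S|\le m(D)$ the function $[F_{S,n}]\Omega(D,\mathfrak G,\mathbf x)$ is an effective character of $\mathfrak G$, that is, the character of a finite-dimensional complex representation (possibly zero). -/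

import Mathlib

/-! ### Quasisymmetric functions -/

/-- The generating function `∑_{f ∈ A} 𝐱^f`, `𝐱^f = ∏_v x_{f v}`, of a set `A` of functions
`N → ℕ` on a finite set `N`, as a formal power series in `x_0, x_1, x_2, …`: the coefficient of a
monomial `d` is the number of `f ∈ A` with `𝐱^f = d`. -/
noncomputable def genFun {N : Type*} [Fintype N] (A : Set (N → ℕ)) : MvPowerSeries ℕ ℂ :=
  fun d => (Nat.card {f : N → ℕ // f ∈ A ∧ ∑ v, Finsupp.single (f v) 1 = d} : ℂ)

/-- The composition `(s₁, s₂ - s₁, …, n - s_k)` of `n` given by a subset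
`{s₁ < ⋯ < s_k}` of `[n-1]`; the element `i : Fin (n - 1)` stands for `i + 1 ∈ [n-1]`. -/
def subsetComposition (n : ℕ) (S : Finset (Fin (n - 1))) : Composition n :=
  ((compositionAsSetEquiv n).symm S).toComposition

/-- The monomial quasisymmetric function
`M_{S,n} = ∑_{i₁ < ⋯ < i_{k+1}} ∏_j x_{i_j}^{s_j - s_{j-1}}`: the coefficient of a monomial `d` is
the number of increasing sequences `i` with `∏_j x_{i_j}^{s_j - s_{j-1}} = d`. -/
noncomputable def monomialQSym (n : ℕ) (S : Finset (Fin (n - 1))) : MvPowerSeries ℕ ℂ :=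
  fun d => (Nat.card {i : Fin (subsetComposition n S).length → ℕ //
    StrictMono i ∧
      ∑ j, Finsupp.single (i j) ((subsetComposition n S).blocksFun j) = d} : ℂ)

/-- The fundamental quasisymmetric function `F_{S,n} = ∑_{T ⊇ S} M_{T,n}`. -/
noncomputable def fundamentalQSym (n : ℕ) (S : Finset (Fin (n - 1))) : MvPowerSeries ℕ ℂ :=
  ∑ T : Finset (Fin (n - 1)) with S ⊆ T, monomialQSym n T

/-- `c` is the family of coefficients of `Φ` in the fundamental basis in degree `n`:
`Φ(g) = ∑_{S ⊆ [n-1]} c_S(g) F_{S,n}` for all `g`. -/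
def IsFundamentalExpansion {G : Type*} (n : ℕ) (Φ : G → MvPowerSeries ℕ ℂ)
    (c : Finset (Fin (n - 1)) → G → ℂ) : Prop :=
  ∀ g, Φ g = ∑ S, c S g • fundamentalQSym n S

/-- `χ` is the character of a finite-dimensional complex representation of `G` (possibly the zero
representation). For finite `G` these are the nonnegative integer combinations of irreducible
characters. -/
def IsEffectiveCharacter {G : Type*} [Group G] (χ : G → ℂ) : Prop :=
  ∃ (d : ℕ) (ρ : Representation ℂ G (Fin d → ℂ)), χ = ρ.character

/-- The functions `f : N → ℕ` in `A` with `g • f = f`, where `(g • f) v = f (g⁻¹ • v)`. -/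
def fixedFunctions {G N : Type*} [Group G] [MulAction G N] (A : Set (N → ℕ)) (g : G) :
    Set (N → ℕ) :=
  {f | f ∈ A ∧ (fun v => f (g⁻¹ • v)) = f}

/-! ### Mixed graphs -/

/-- A mixed graph: undirected edges and directed edges on the same vertex set. -/
structure MixedGraph (V : Type*) where
  undirected : SimpleGraph V
  directed : Digraph V

namespace MixedGraph

variable {V : Type*}

/-- A permutation of the vertices is an automorphism if it preserves undirected and directed
edges. -/
def IsAutomorphism (Γ : MixedGraph V) (σ : Equiv.Perm V) : Prop :=
  (∀ u v, Γ.undirected.Adj (σ u) (σ v) ↔ Γ.undirected.Adj u v) ∧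
    ∀ u v, Γ.directed.Adj (σ u) (σ v) ↔ Γ.directed.Adj u v

/-- Weak colorings. -/
def weakColorings (Γ : MixedGraph V) : Set (V → ℕ) :=
  {f | (∀ u v, Γ.undirected.Adj u v → f u ≠ f v) ∧ ∀ u v, Γ.directed.Adj u v → f u ≤ f v}

/-- `χ(Γ, 𝔊, 𝐱; g)`: the generating function of the weak colorings fixed by `g`. -/
noncomputable def chromaticQSym [Fintype V] (Γ : MixedGraph V) (G : Type*) [Group G]
    [MulAction G V] (g : G) : MvPowerSeries ℕ ℂ :=
  genFun (fixedFunctions Γ.weakColorings g)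

/-- `w 0, w 1, …, w (k+2), w 0` is a mixed cycle of length `k + 3`: the vertices are distinct, the
edges with index in `E` are undirected, the others are directed edges followed in their direction,
and at least one of them is directed. -/
def IsMixedCycle (Γ : MixedGraph V) {k : ℕ} (w : Fin (k + 3) → V) (E : Finset (Fin (k + 3))) :
    Prop :=
  Function.Injective w ∧ (∀ i ∈ E, Γ.undirected.Adj (w i) (w (i + 1))) ∧
    (∀ i ∉ E, Γ.directed.Adj (w i) (w (i + 1))) ∧ ∃ i, i ∉ E

/-- The numbers of undirected edges on the mixed cycles of `Γ`. -/
def mixedCycleCounts (Γ : MixedGraph V) : Set ℕ :=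
  {j | ∃ (k : ℕ) (w : Fin (k + 3) → V) (E : Finset (Fin (k + 3))),
    Γ.IsMixedCycle w E ∧ E.card = j}

open Classical in
/-- `m(Γ)`: the minimum number of undirected edges on a mixed cycle, and the number of vertices if
there is no mixed cycle. -/
noncomputable def m [Fintype V] (Γ : MixedGraph V) : ℕ :=
  if Γ.mixedCycleCounts.Nonempty then sInf Γ.mixedCycleCounts else Fintype.card V

end MixedGraph

/-! ### Double posets -/

/-- A double poset on `N`: two partial orders on `N`. -/
structure DoublePoset (N : Type*) where
  ord₁ : PartialOrder N
  ord₂ : PartialOrder N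

namespace DoublePoset

variable {N : Type*}

/-- `a ≤₁ b` -/
def le₁ (D : DoublePoset N) (a b : N) : Prop := D.ord₁.le a b

/-- `a ≤₂ b` -/
def le₂ (D : DoublePoset N) (a b : N) : Prop := D.ord₂.le a b

/-- `a <₁ b` -/
def lt₁ (D : DoublePoset N) (a b : N) : Prop := D.ord₁.lt a b

/-- `a <₂ b` -/
def lt₂ (D : DoublePoset N) (a b : N) : Prop := D.ord₂.lt a b

/-- `a ≺₁ b`: `b` covers `a` in the first order. -/
def covBy₁ (D : DoublePoset N) (a b : N) : Prop :=
  D.lt₁ a b ∧ ∀ c, ¬ (D.lt₁ a c ∧ D.lt₁ c b)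

/-- `(a, b)` is an inversion. -/
def IsInversion (D : DoublePoset N) (a b : N) : Prop := D.lt₁ a b ∧ D.lt₂ b a

/-- `(a, b)` is a descent. -/
def IsDescent (D : DoublePoset N) (a b : N) : Prop := D.IsInversion a b ∧ D.covBy₁ a b

/-- Every inversion is a descent or can be shortened to an inversion. -/
def InversionReducible (D : DoublePoset N) : Prop :=
  ∀ a b, D.IsInversion a b → D.IsDescent a b ∨
    ∃ c, D.lt₁ a c ∧ D.lt₁ c b ∧ (D.IsInversion a c ∨ D.IsInversion c b)

/-- `D`-partitions. -/
def partitions (D : DoublePoset N) : Set (N → ℕ) :=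
  {f | (∀ i j, D.le₁ i j → f i ≤ f j) ∧ ∀ i j, D.lt₁ i j → D.lt₂ j i → f i < f j}

/-- `𝔊` acts on `D`, i.e. by automorphisms of the double poset. -/
def ActsOn (G : Type*) [Group G] [MulAction G N] (D : DoublePoset N) : Prop :=
  ∀ (g : G) (i j : N), (D.le₁ i j → D.le₁ (g • i) (g • j)) ∧ (D.le₂ i j → D.le₂ (g • i) (g • j))

/-- `Ω(D, 𝔊, 𝐱; g)`: the generating function of the `D`-partitions fixed by `g`. -/
noncomputable def partitionQSym [Fintype N] (D : DoublePoset N) (G : Type*) [Group G]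
    [MulAction G N] (g : G) : MvPowerSeries ℕ ℂ :=
  genFun (fixedFunctions D.partitions g)

/-- The mixed graph `G(D)`: its directed edges are the pairs `(u, v)` with `u ≺₁ v`, its undirected
edges the pairs `uv` with `u ≺₁ v` and `v ≤₂ u`. -/
def mixedGraph (D : DoublePoset N) : MixedGraph N where
  undirected := SimpleGraph.fromRel fun u v => D.covBy₁ u v ∧ D.le₂ v u
  directed := { Adj := D.covBy₁ }

end DoublePoset

/-!
The `D`-partitions are the weak colorings of the mixed graph: inversion-reducibility places a
descent inside every inversion. A weak coloring is determined by its values together with the chain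
of its initial segments, so that by Möbius inversion the coefficient of `F_{S,n}` at `g` is, up to
sign, the alternating count of the chains fixed by `g` whose members have cardinalities in `S`.
These chains form a relative simplicial complex, properly colored by cardinality, and by the Hopf
trace formula the alternating count is the alternating sum of the characters of its cohomology
groups. If `|S| ≤ m`, all of them vanish except in the top degree `|S|`, whose character remains.
For the vanishing one removes the strictness conditions one at a time, each of which is the
difference between no condition and the reversed weak inequality. Reversing a set `A` of fewer than
`m` strict pairs loses at most `|A|` classes of mutually reachable vertices, since a greater loss
would close up to a mixed cycle with at most `|A|` undirected edges; hence the remaining relation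
has enough order ideals.
-/

/-! ### Cochains of relative simplicial complexes with colored vertices -/

section Cochains

/-- The functions on `Y` that vanish outside `P`. -/
def supportedOn {Y : Type*} (P : Set Y) : Submodule ℂ (Y → ℂ) := Submodule.pi Pᶜ fun _ => ⊥

theorem mem_supportedOn {Y : Type*} {P : Set Y} {φ : Y → ℂ} :
    φ ∈ supportedOn P ↔ ∀ y ∉ P, φ y = 0 := Iff.rfl

theorem supportedOn_mono {Y : Type*} {P Q : Set Y} (h : P ⊆ Q) : supportedOn P ≤ supportedOn Q :=
  fun _ hφ y hy => hφ y fun hP => hy (h hP)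

variable {V : Type*}

open Classical in
/-- The incidence sign of the vertex `I` in the face `F`, whose vertices are ordered by their
colors `κ`. -/
noncomputable def incidence (κ : V → ℕ) (F : Finset V) (I : V) : ℂ :=
  (-1) ^ (F.filter fun J => κ J < κ I).card

open Classical in
/-- The coboundary operator of a set `X` of faces. Cochains are functions on all finite sets of
vertices; the part of the coboundary outside `X` is discarded. -/
noncomputable def coboundary (κ : V → ℕ) (X : Set (Finset V)) :
    (Finset V → ℂ) →ₗ[ℂ] (Finset V → ℂ) where
  toFun φ := X.indicator fun F => ∑ I ∈ F, incidence κ F I * φ (F.erase I)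
  map_add' φ ψ := by
    simp only [Pi.add_apply, mul_add, Finset.sum_add_distrib]
    exact Set.indicator_add X _ _
  map_smul' a φ := by
    simp only [Pi.smul_apply, smul_eq_mul, mul_left_comm _ a, ← Finset.mul_sum]
    exact Set.indicator_const_smul X a _

/-- The cochains of `X` of degree `i`, that is, supported on the faces with `i` vertices. The
degree is an integer, so that the degree below `i` is always `i - 1`. -/
def cochains (X : Set (Finset V)) (i : ℤ) : Submodule ℂ (Finset V → ℂ) :=
  supportedOn {F ∈ X | (F.card : ℤ) = i}

/-- The cohomology of `X` vanishes in degree `i`. -/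
def AcyclicAt (κ : V → ℕ) (X : Set (Finset V)) (i : ℤ) : Prop :=
  ∀ φ ∈ cochains X i, coboundary κ X φ = 0 → ∃ ψ ∈ cochains X (i - 1), coboundary κ X ψ = φ

variable {κ : V → ℕ} {X A : Set (Finset V)} {i : ℤ} {φ : Finset V → ℂ} {F : Finset V}

theorem cochains_le_supportedOn : cochains X i ≤ supportedOn X :=
  supportedOn_mono (Set.sep_subset _ _)

theorem cochains_mono (h : A ⊆ X) : cochains A i ≤ cochains X i :=
  supportedOn_mono fun _ hF => ⟨h hF.1, hF.2⟩

theorem mem_cochains_of_mem_supportedOn (hφ : φ ∈ cochains X i) (hA : φ ∈ supportedOn A) :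
    φ ∈ cochains A i := fun F hF => by
  by_cases h : F ∈ A
  · exact hφ F fun hX => hF ⟨h, hX.2⟩
  · exact hA F h

theorem coboundary_apply_of_mem [DecidableEq V] (φ : Finset V → ℂ) (h : F ∈ X) :
    coboundary κ X φ F = ∑ I ∈ F, incidence κ F I * φ (F.erase I) := by
  rw [coboundary, LinearMap.coe_mk, AddHom.coe_mk, Set.indicator_of_mem h]
  congr!

theorem coboundary_apply_of_notMem (φ : Finset V → ℂ) (h : F ∉ X) : coboundary κ X φ F = 0 := by
  rw [coboundary, LinearMap.coe_mk, AddHom.coe_mk, Set.indicator_of_notMem h]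

theorem coboundary_mem_cochains (hφ : φ ∈ cochains A (i - 1)) :
    coboundary κ X φ ∈ cochains X i := by
  classical
  intro F hF
  by_cases hX : F ∈ X
  · rw [coboundary_apply_of_mem _ hX]
    refine Finset.sum_eq_zero fun I hI => ?_
    rw [hφ (F.erase I), mul_zero]
    rintro ⟨-, hcard⟩
    rw [Finset.cast_card_erase_of_mem hI, sub_left_inj] at hcard
    exact hF ⟨hX, hcard⟩
  · exact coboundary_apply_of_notMem _ hX

section Incidence

variable {I J : V}

theorem incidence_eq_one (h : ∀ J ∈ F, κ I ≤ κ J) : incidence κ F I = 1 := by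
  classical
  rw [incidence, Finset.filter_false_of_mem fun J hJ => (h J hJ).not_gt, Finset.card_empty,
    pow_zero]

variable [DecidableEq V]

theorem incidence_erase_of_lt (h : κ J < κ I) :
    incidence κ (F.erase I) J = incidence κ F J := by
  classical
  have hI : I ∉ F.filter fun K => κ K < κ J := fun hI => h.not_gt (Finset.mem_filter.1 hI).2
  rw [incidence, Finset.filter_erase, Finset.erase_eq_of_notMem hI, incidence]

theorem incidence_erase_of_gt (hJ : J ∈ F) (h : κ J < κ I) :
    incidence κ (F.erase J) I = -incidence κ F I := by
  classical
  rw [incidence, incidence, Finset.filter_erase,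
    ← Finset.card_erase_add_one (Finset.mem_filter.2 ⟨hJ, h⟩), pow_succ, mul_neg_one, neg_neg]

theorem incidence_mul_incidence_erase (hκ : Set.InjOn κ F) (hI : I ∈ F) (hJ : J ∈ F)
    (h : I ≠ J) :
    incidence κ F I * incidence κ (F.erase I) J =
      -(incidence κ F J * incidence κ (F.erase J) I) := by
  rcases lt_or_gt_of_ne (hκ.ne hI hJ h) with hlt | hlt
  · rw [incidence_erase_of_gt hI hlt, incidence_erase_of_lt hlt]
    ring
  · rw [incidence_erase_of_gt hJ hlt, incidence_erase_of_lt hlt]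
    ring

theorem coboundary_coboundary_apply (hX : X.OrdConnected) (hφ : φ ∈ supportedOn X) (hF : F ∈ X) :
    coboundary κ X (coboundary κ X φ) F = ∑ p ∈ F.sigma fun I => F.erase I,
      incidence κ F p.1 * incidence κ (F.erase p.1) p.2 * φ ((F.erase p.1).erase p.2) := by
  have inner_sum (I : V) : coboundary κ X φ (F.erase I) =
      ∑ J ∈ F.erase I, incidence κ (F.erase I) J * φ ((F.erase I).erase J) := by
    by_cases h : F.erase I ∈ X
    · exact coboundary_apply_of_mem _ h
    · rw [coboundary_apply_of_notMem _ h, Finset.sum_eq_zero]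
      intro J _
      rw [hφ _ fun hJ => h (hX.out hJ hF ⟨Finset.erase_subset _ _, Finset.erase_subset _ _⟩),
        mul_zero]
  simp only [coboundary_apply_of_mem _ hF, inner_sum, Finset.mul_sum, Finset.sum_sigma, mul_assoc]

end Incidence

theorem coboundary_coboundary (hX : X.OrdConnected) (hκ : ∀ F ∈ X, Set.InjOn κ F)
    (hφ : φ ∈ supportedOn X) : coboundary κ X (coboundary κ X φ) = 0 := by
  classical
  funext F
  by_cases hF : F ∈ X
  swap
  · exact coboundary_apply_of_notMem _ hF
  rw [coboundary_coboundary_apply hX hφ hF]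
  refine Finset.sum_involution (fun p _ => ⟨p.2, p.1⟩) ?_ ?_ ?_ fun _ _ => rfl
  · rintro ⟨I, J⟩ hp
    obtain ⟨hI, hne, hJ⟩ : I ∈ F ∧ J ≠ I ∧ J ∈ F := by simpa using hp
    dsimp only
    rw [incidence_mul_incidence_erase (hκ F hF) hI hJ hne.symm, Finset.erase_right_comm]
    ring
  · rintro ⟨I, J⟩ hp - heq
    obtain rfl : J = I := congrArg Sigma.fst heq
    simp at hp
  · rintro ⟨I, J⟩ hp
    simp only [Finset.mem_sigma, Finset.mem_erase] at hp ⊢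
    exact ⟨hp.2.2, hp.2.1.symm, hp.1⟩

section RelUpperSet

theorem coboundary_eq_of_isRelUpperSet (hA : IsRelUpperSet A (· ∈ X)) (hφ : φ ∈ supportedOn A) :
    coboundary κ X φ = coboundary κ A φ := by
  classical
  funext F
  by_cases hFA : F ∈ A
  · rw [coboundary_apply_of_mem _ hFA, coboundary_apply_of_mem _ (hA hFA).1]
  rw [coboundary_apply_of_notMem _ hFA]
  by_cases hFX : F ∈ X
  · rw [coboundary_apply_of_mem _ hFX]
    refine Finset.sum_eq_zero fun I _ => ?_
    rw [hφ _ fun h => hFA ((hA h).2 (Finset.erase_subset _ _) hFX), mul_zero]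
  · exact coboundary_apply_of_notMem _ hFX

theorem coboundary_indicator_sdiff (hA : IsRelUpperSet A (· ∈ X)) (hφ : φ ∈ supportedOn X) :
    coboundary κ (X \ A) ((X \ A).indicator φ) = (X \ A).indicator (coboundary κ X φ) := by
  classical
  funext F
  by_cases hF : F ∈ X \ A
  swap
  · rw [coboundary_apply_of_notMem _ hF, Set.indicator_of_notMem hF]
  rw [Set.indicator_of_mem hF, coboundary_apply_of_mem _ hF, coboundary_apply_of_mem _ hF.1]
  refine Finset.sum_congr rfl fun I _ => congrArg _ ?_
  by_cases hX : F.erase I ∈ X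
  · have hXA : F.erase I ∈ X \ A :=
      ⟨hX, fun h => hF.2 ((hA h).2 (Finset.erase_subset _ _) hF.1)⟩
    rw [Set.indicator_of_mem hXA]
  · rw [Set.indicator_of_notMem (fun h => hX h.1), hφ _ hX]

theorem indicator_mem_cochains (hφ : φ ∈ cochains X i) :
    (X \ A).indicator φ ∈ cochains (X \ A) i := by
  intro F hF
  by_cases h : F ∈ X \ A
  · exact (Set.indicator_of_mem h φ).trans (hφ F fun hX => hF ⟨h, hX.2⟩)
  · exact Set.indicator_of_notMem h φ

theorem sub_coboundary_mem_cochains (hA : IsRelUpperSet A (· ∈ X)) {η : Finset V → ℂ}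
    (hφ : φ ∈ cochains X i) (hη : η ∈ cochains (X \ A) (i - 1))
    (hηφ : coboundary κ (X \ A) η = (X \ A).indicator φ) :
    φ - coboundary κ X η ∈ cochains A i := by
  have hmem : φ - coboundary κ X η ∈ cochains X i :=
    Submodule.sub_mem _ hφ (coboundary_mem_cochains hη)
  refine mem_cochains_of_mem_supportedOn hmem fun F hFA => ?_
  by_cases hFX : F ∈ X
  swap
  · exact cochains_le_supportedOn hmem F hFX
  have hη' : (X \ A).indicator η = η :=
    Set.indicator_eq_self.2 (Function.support_subset_iff'.2 (cochains_le_supportedOn hη))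
  have hcob := coboundary_indicator_sdiff (κ := κ) hA
    (cochains_le_supportedOn (cochains_mono Set.sdiff_subset hη))
  rw [hη', hηφ] at hcob
  have hF : F ∈ X \ A := ⟨hFX, hFA⟩
  have hcobF := congrFun hcob F
  rw [Set.indicator_of_mem hF, Set.indicator_of_mem hF] at hcobF
  exact sub_eq_zero.2 hcobF

theorem AcyclicAt.of_isRelUpperSet (hA : IsRelUpperSet A (· ∈ X)) (hX : X.OrdConnected)
    (hκ : ∀ F ∈ X, Set.InjOn κ F) (hAi : AcyclicAt κ A i) (hBi : AcyclicAt κ (X \ A) i) :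
    AcyclicAt κ X i := by
  intro φ hφ hδ
  have hδB : coboundary κ (X \ A) ((X \ A).indicator φ) = 0 := by
    rw [coboundary_indicator_sdiff hA (cochains_le_supportedOn hφ), hδ]
    exact Set.indicator_zero' _
  obtain ⟨η, hη, hηφ⟩ := hBi _ (indicator_mem_cochains hφ) hδB
  have hηX := cochains_mono Set.sdiff_subset hη
  have hsub := sub_coboundary_mem_cochains hA hφ hη hηφ
  obtain ⟨ζ, hζ, hζφ⟩ := hAi _ hsub <| by
    rw [← coboundary_eq_of_isRelUpperSet hA (cochains_le_supportedOn hsub), map_sub, hδ,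
      coboundary_coboundary hX hκ (cochains_le_supportedOn hηX), sub_zero]
  refine ⟨ζ + η, Submodule.add_mem _ (cochains_mono (fun F hF => (hA hF).1) hζ) hηX, ?_⟩
  rw [map_add, coboundary_eq_of_isRelUpperSet hA (cochains_le_supportedOn hζ), hζφ,
    sub_add_cancel]

theorem AcyclicAt.left_of_isRelUpperSet (hA : IsRelUpperSet A (· ∈ X)) (hX : X.OrdConnected)
    (hκ : ∀ F ∈ X, Set.InjOn κ F) (hXi : AcyclicAt κ X i) (hBi : AcyclicAt κ (X \ A) (i - 1)) :
    AcyclicAt κ A i := by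
  intro φ hφ hδ
  have hφA := cochains_le_supportedOn hφ
  obtain ⟨ψ, hψ, hψφ⟩ := hXi φ (cochains_mono (fun F hF => (hA hF).1) hφ) <| by
    rw [coboundary_eq_of_isRelUpperSet hA hφA, hδ]
  have hδB : coboundary κ (X \ A) ((X \ A).indicator ψ) = 0 := by
    rw [coboundary_indicator_sdiff hA (cochains_le_supportedOn hψ), hψφ]
    exact Set.indicator_eq_zero'.2
      (Set.disjoint_left.2 fun F hF hFB => hF (hφA F hFB.2))
  obtain ⟨η, hη, hηψ⟩ := hBi _ (indicator_mem_cochains hψ) hδB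
  have hsub := sub_coboundary_mem_cochains hA hψ hη hηψ
  refine ⟨ψ - coboundary κ X η, hsub, ?_⟩
  rw [← coboundary_eq_of_isRelUpperSet hA (cochains_le_supportedOn hsub), map_sub, hψφ,
    coboundary_coboundary hX hκ
      (cochains_le_supportedOn (cochains_mono Set.sdiff_subset hη)), sub_zero]

end RelUpperSet

section Simplex

variable {L : Finset V} {I₀ : V}

section Cone

variable [DecidableEq V]

/-- The cone operator with apex `I₀`. If `I₀` has the smallest color among the vertices of a
simplex, it is a contracting homotopy of the cochain complex of that simplex. -/
def coneOperator (I₀ : V) (φ : Finset V → ℂ) (F : Finset V) : ℂ :=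
  if I₀ ∈ F then 0 else φ (insert I₀ F)

theorem coneOperator_mem_cochains (hφ : φ ∈ cochains (Set.Iic L) i) :
    coneOperator I₀ φ ∈ cochains (Set.Iic L) (i - 1) := by
  intro F hF
  rw [coneOperator]
  split_ifs with h
  · rfl
  refine hφ _ fun hins => hF ⟨(Finset.subset_insert _ _).trans hins.1, ?_⟩
  rw [← hins.2, Finset.card_insert_of_notMem h, Nat.cast_succ, add_sub_cancel_right]

theorem coboundary_coneOperator_add (hI₀ : I₀ ∈ L) (hmin : ∀ I ∈ L, I ≠ I₀ → κ I₀ < κ I)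
    (φ : Finset V → ℂ) (hF : F ⊆ L) :
    coboundary κ (Set.Iic L) (coneOperator I₀ φ) F +
      coneOperator I₀ (coboundary κ (Set.Iic L) φ) F = φ F := by
  have incidence_cone {F : Finset V} (hF : F ⊆ L) : incidence κ F I₀ = 1 :=
    incidence_eq_one fun J hJ => (eq_or_ne J I₀).elim (fun h => h ▸ le_rfl)
      fun h => (hmin J (hF hJ) h).le
  rw [coboundary_apply_of_mem _ (Set.mem_Iic.2 hF)]
  by_cases h : I₀ ∈ F
  · rw [Finset.sum_eq_single I₀ (fun I _ hI => by simp [coneOperator, h, hI.symm])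
      (absurd h), incidence_cone hF]
    simp [coneOperator, h]
  have hins : insert I₀ F ⊆ L := Finset.insert_subset hI₀ hF
  rw [coneOperator, if_neg h, coboundary_apply_of_mem _ (Set.mem_Iic.2 hins),
    Finset.sum_insert h, incidence_cone hins, Finset.erase_insert h, one_mul, add_left_comm,
    ← Finset.sum_add_distrib, Finset.sum_eq_zero, add_zero]
  intro I hI
  have hne : I ≠ I₀ := fun e => h (e ▸ hI)
  have hsign := incidence_erase_of_gt (Finset.mem_insert_self I₀ F) (hmin I (hF hI) hne)
  rw [Finset.erase_insert h] at hsign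
  rw [coneOperator, if_neg fun h' => h (Finset.mem_of_mem_erase h'), hsign,
    Finset.erase_insert_of_ne hne.symm]
  ring

end Cone

theorem acyclicAt_Iic (hL : L.Nonempty) (hκ : Set.InjOn κ L) : AcyclicAt κ (Set.Iic L) i := by
  classical
  intro φ hφ hδ
  obtain ⟨I₀, hI₀, hle⟩ := L.exists_min_image κ hL
  have hmin (I : V) (hI : I ∈ L) (hne : I ≠ I₀) : κ I₀ < κ I :=
    (hle I hI).lt_of_ne (hκ.ne hI₀ hI hne.symm)
  refine ⟨coneOperator I₀ φ, coneOperator_mem_cochains hφ, funext fun F => ?_⟩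
  by_cases hF : F ⊆ L
  · have hhomotopy := coboundary_coneOperator_add hI₀ hmin φ hF
    rw [hδ] at hhomotopy
    simpa [coneOperator] using hhomotopy
  · rw [coboundary_apply_of_notMem _ hF, cochains_le_supportedOn hφ F hF]

end Simplex

end Cochains

/-! ### Classes of the preorder generated by a relation -/

section Classes

open Relation

variable {N : Type*} {r r' : N → N → Prop} {u v x y : N}

/-- The relation `r` together with the pair `(u, v)`. -/
def addPair (r : N → N → Prop) (u v : N) : N → N → Prop := fun x y => r x y ∨ x = u ∧ y = v

/-- The relation `r` together with the reversals `(v, u)` of the pairs `(u, v) ∈ A`. -/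
def addReverse (r : N → N → Prop) (A : Finset (N × N)) : N → N → Prop :=
  fun x y => r x y ∨ (y, x) ∈ A

/-- The number of equivalence classes of the preorder generated by `r`. -/
noncomputable def numClasses (r : N → N → Prop) : ℕ :=
  Nat.card (Antisymmetrization N (ReflTransGen r))

theorem addReverse_empty (r : N → N → Prop) : addReverse r ∅ = r := by
  funext x y
  simp [addReverse]

theorem addReverse_insert [DecidableEq N] (r : N → N → Prop) (u v : N) (A : Finset (N × N)) :
    addReverse r (insert (u, v) A) = addReverse (addPair r v u) A := by
  funext x y
  simp only [addReverse, addPair, Finset.mem_insert, Prod.mk.injEq, eq_iff_iff]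
  tauto

theorem addReverse_insert' [DecidableEq N] (r : N → N → Prop) (u v : N) (A : Finset (N × N)) :
    addReverse r (insert (u, v) A) = addPair (addReverse r A) v u := by
  funext x y
  simp only [addReverse, addPair, Finset.mem_insert, Prod.mk.injEq, eq_iff_iff]
  tauto

theorem reflTransGen_addPair :
    ReflTransGen (addPair r u v) x y ↔
      ReflTransGen r x y ∨ ReflTransGen r x u ∧ ReflTransGen r v y := by
  constructor
  · intro h
    induction h with
    | refl => exact Or.inl .refl
    | tail _ hstep ih =>
      rcases hstep with hstep | ⟨rfl, rfl⟩
      · exact ih.imp (·.tail hstep) fun h => ⟨h.1, h.2.tail hstep⟩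
      · exact Or.inr ⟨ih.elim id (·.1), .refl⟩
  · have hmono {a b : N} : ReflTransGen r a b → ReflTransGen (addPair r u v) a b :=
      ReflTransGen.mono (fun _ _ => Or.inl) a b
    rintro (h | ⟨hxu, hvy⟩)
    · exact hmono h
    · exact ((hmono hxu).tail (Or.inr ⟨rfl, rfl⟩)).trans (hmono hvy)

variable [Finite N]

theorem card_le_numClasses_of_antisymm (hr : Std.Antisymm (ReflTransGen r)) :
    Nat.card N ≤ numClasses r := by
  have : Finite (Antisymmetrization N (ReflTransGen r)) := Quotient.finite _
  refine Nat.card_le_card_of_injective (toAntisymmetrization _) fun x y hxy => ?_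
  obtain ⟨h, h'⟩ := Quotient.exact hxy
  exact hr.antisymm x y h h'

theorem numClasses_le_of_imp
    (h : ∀ x y, AntisymmRel (ReflTransGen r') x y → AntisymmRel (ReflTransGen r) x y) :
    numClasses r ≤ numClasses r' :=
  have : Finite (Antisymmetrization N (ReflTransGen r')) := Quotient.finite _
  Nat.card_le_card_of_surjective (Quotient.map' id h) <|
    Quotient.ind fun x => ⟨toAntisymmetrization _ x, rfl⟩

theorem numClasses_le_add_one_of_imp (u v : N)
    (h : ∀ x y, AntisymmRel (ReflTransGen r') x y → AntisymmRel (ReflTransGen r) x y ∨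
      (AntisymmRel (ReflTransGen r) x u ∨ AntisymmRel (ReflTransGen r) x v) ∧
        (AntisymmRel (ReflTransGen r) y u ∨ AntisymmRel (ReflTransGen r) y v)) :
    numClasses r ≤ numClasses r' + 1 := by
  classical
  have : Finite (Antisymmetrization N (ReflTransGen r')) := Quotient.finite _
  -- Only the class of `v` may be joined to another one: send it to the additional point `none`.
  let classMap (p : Antisymmetrization N (ReflTransGen r)) :
      Option (Antisymmetrization N (ReflTransGen r')) :=
    if AntisymmRel (ReflTransGen r) p.out v then none else some (toAntisymmetrization _ p.out)
  have hinj : Function.Injective classMap := by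
    intro p q hpq
    suffices hout : AntisymmRel (ReflTransGen r) p.out q.out by
      rw [← p.out_eq, ← q.out_eq]
      exact Quotient.sound hout
    by_cases hp : AntisymmRel (ReflTransGen r) p.out v <;>
      by_cases hq : AntisymmRel (ReflTransGen r) q.out v <;>
      simp only [classMap, hp, hq, if_true, if_false, reduceCtorEq, Option.some.injEq] at hpq
    · exact hp.trans hq.symm
    · rcases h _ _ (Quotient.exact hpq) with hclass | ⟨hpu, hqu⟩
      · exact hclass
      · exact (hpu.resolve_right hp).trans (hqu.resolve_right hq).symm
  simpa only [numClasses, Finite.card_option] using Nat.card_le_card_of_injective _ hinj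

theorem numClasses_le_addPair (h : ¬ ReflTransGen r v u) :
    numClasses r ≤ numClasses (addPair r u v) := by
  refine numClasses_le_of_imp fun x y ⟨hxy, hyx⟩ => ?_
  rw [reflTransGen_addPair] at hxy hyx
  rcases hxy with hxy | ⟨hxu, hvy⟩ <;> rcases hyx with hyx | ⟨hyu, hvx⟩
  · exact ⟨hxy, hyx⟩
  · exact absurd ((hvx.trans hxy).trans hyu) h
  · exact absurd ((hvy.trans hyx).trans hxu) h
  · exact absurd (hvy.trans hyu) h

theorem numClasses_le_addPair_add_one
    (h : ∀ x, ReflTransGen r u x → ReflTransGen r x v →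
      AntisymmRel (ReflTransGen r) x u ∨ AntisymmRel (ReflTransGen r) x v) :
    numClasses r ≤ numClasses (addPair r v u) + 1 := by
  refine numClasses_le_add_one_of_imp u v fun x y ⟨hxy, hyx⟩ => ?_
  rw [reflTransGen_addPair] at hxy hyx
  rcases hxy with hxy | ⟨hxv, huy⟩ <;> rcases hyx with hyx | ⟨hyv, hux⟩
  · exact Or.inl ⟨hxy, hyx⟩
  · exact Or.inr ⟨h x hux (hxy.trans hyv), h y (hux.trans hxy) hyv⟩
  · exact Or.inr ⟨h x (huy.trans hyx) hxv, h y huy (hyx.trans hxv)⟩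
  · exact Or.inr ⟨h x hux hxv, h y huy hyv⟩

theorem numClasses_addPair_le_addPair_addPair_add_one (huv : ¬ ReflTransGen r u v)
    (hvu : ¬ ReflTransGen r v u) :
    numClasses (addPair r v u) ≤ numClasses (addPair (addPair r v u) u v) + 1 := by
  refine numClasses_le_addPair_add_one fun x hvx hxu => ?_
  simp only [AntisymmRel, reflTransGen_addPair] at hvx hxu ⊢
  rcases hvx with hvx | ⟨-, hux⟩ <;> rcases hxu with hxu | ⟨hxv, -⟩
  · exact absurd (hvx.trans hxu) hvu
  · exact Or.inl ⟨Or.inl hxv, Or.inl hvx⟩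
  · exact Or.inr ⟨Or.inl hxu, Or.inl hux⟩
  · exact absurd (hux.trans hxv) huv

end Classes

/-! ### Chains of predecessor-closed sets -/

section Faces

open Relation

variable {N : Type*}

/-- `I` is closed under predecessors for `r`. -/
def IsPredClosed (r : N → N → Prop) (I : Finset N) : Prop := ∀ x y, r x y → y ∈ I → x ∈ I

/-- The chains of sets with cardinality in `S` that are closed under predecessors for `r` and
separate every pair in `W`. They encode the functions on `N`, up to the values taken, that are
weakly increasing along `r`, strictly increasing along `W`, and for which the cardinalities of the
initial segments are in `S`. -/
def faces (r : N → N → Prop) (W : Finset (N × N)) (S : Finset ℕ) : Set (Finset (Finset N)) :=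
  {F | IsChain (· ⊆ ·) (F : Set (Finset N)) ∧ (∀ I ∈ F, I.card ∈ S ∧ IsPredClosed r I) ∧
    ∀ p ∈ W, ∃ I ∈ F, p.1 ∈ I ∧ p.2 ∉ I}

variable {r : N → N → Prop} {W : Finset (N × N)} {S : Finset ℕ} {u v : N} {i : ℤ}

theorem isPredClosed_addPair {I : Finset N} :
    IsPredClosed (addPair r u v) I ↔ IsPredClosed r I ∧ (v ∈ I → u ∈ I) := by
  refine ⟨fun h => ⟨fun x y hxy => h x y (Or.inl hxy), h u v (Or.inr ⟨rfl, rfl⟩)⟩, ?_⟩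
  rintro ⟨h, huv⟩ x y (hxy | ⟨rfl, rfl⟩)
  · exact h x y hxy
  · exact huv

theorem IsPredClosed.mem_of_reflTransGen {I : Finset N} (hI : IsPredClosed r I) {x y : N}
    (h : ReflTransGen r x y) (hy : y ∈ I) : x ∈ I := by
  induction h with
  | refl => exact hy
  | tail _ hstep ih => exact ih (hI _ _ hstep hy)

theorem injOn_card_of_isChain {F : Set (Finset N)} (h : IsChain (· ⊆ ·) F) :
    Set.InjOn Finset.card F := fun I hI J hJ hcard => by
  rcases h.total hI hJ with hIJ | hJI
  · exact Finset.eq_of_subset_of_card_le hIJ hcard.ge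
  · exact (Finset.eq_of_subset_of_card_le hJI hcard.le).symm

theorem injOn_card_of_mem_faces (F : Finset (Finset N)) (hF : F ∈ faces r W S) :
    Set.InjOn Finset.card (F : Set (Finset N)) :=
  injOn_card_of_isChain hF.1

theorem ordConnected_faces : (faces r W S).OrdConnected := by
  refine ⟨fun F hF F'' hF'' F' hF' => ⟨hF''.1.mono (Finset.coe_subset.2 hF'.2),
    fun I hI => hF''.2.1 I (hF'.2 hI), fun p hp => ?_⟩⟩
  obtain ⟨I, hI, hsep⟩ := hF.2.2 p hp
  exact ⟨I, hF'.1 hI, hsep⟩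

open scoped Pointwise in
theorem smul_mem_faces [DecidableEq N] {G : Type*} [Group G] [MulAction G N]
    (hr : ∀ (g : G) u v, r u v → r (g • u) (g • v))
    (hW : ∀ (g : G), ∀ p ∈ W, (g • p.1, g • p.2) ∈ W) (g : G) {F : Finset (Finset N)}
    (hF : F ∈ faces r W S) : g • F ∈ faces r W S := by
  obtain ⟨hchain, hclosed, hsep⟩ := hF
  refine ⟨?_, fun I hI => ?_, fun p hp => ?_⟩
  · rw [Finset.coe_smul_finset]
    exact IsChain.image_of_map_rel _ _ _ (fun _ _ h => Finset.smul_finset_subset_smul_finset h)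
      hchain
  · obtain ⟨hcard, hclosedI⟩ := hclosed _ (Finset.inv_smul_mem_iff.2 hI)
    refine ⟨by rwa [Finset.card_smul_finset] at hcard, fun u v huv hv => ?_⟩
    simp only [IsPredClosed, Finset.mem_inv_smul_finset_iff] at hclosedI
    simpa using hclosedI _ _ (hr g⁻¹ u v huv) (by simpa using hv)
  · obtain ⟨I, hI, hu, hv⟩ := hsep _ (hW g⁻¹ p hp)
    exact ⟨g • I, Finset.smul_mem_smul_finset hI, Finset.inv_smul_mem_iff.1 hu,
      fun h => hv (Finset.inv_smul_mem_iff.2 h)⟩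

theorem mem_faces_insert [DecidableEq N] {F : Finset (Finset N)} :
    F ∈ faces r (insert (u, v) W) S ↔ F ∈ faces r W S ∧ ∃ I ∈ F, u ∈ I ∧ v ∉ I := by
  simp only [faces, Set.mem_ofPred_eq, Finset.forall_mem_insert]
  tauto

theorem mem_faces_addPair {F : Finset (Finset N)} :
    F ∈ faces (addPair r u v) W S ↔ F ∈ faces r W S ∧ ∀ I ∈ F, v ∈ I → u ∈ I := by
  simp only [faces, Set.mem_ofPred_eq, isPredClosed_addPair, ← and_assoc, forall_and]
  tauto

theorem isRelUpperSet_faces_insert [DecidableEq N] (u v : N) :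
    IsRelUpperSet (faces r (insert (u, v) W) S) (· ∈ faces r W S) := by
  refine fun F hF => ⟨(mem_faces_insert.1 hF).1, fun F' hsub hF' => mem_faces_insert.2 ⟨hF', ?_⟩⟩
  obtain ⟨I, hI, hsep⟩ := (mem_faces_insert.1 hF).2
  exact ⟨I, hsub hI, hsep⟩

theorem faces_sdiff_faces_insert [DecidableEq N] (u v : N) :
    faces r W S \ faces r (insert (u, v) W) S = faces (addPair r v u) W S := by
  ext F
  rw [Set.mem_sdiff, mem_faces_insert, mem_faces_addPair]
  refine and_congr_right fun hF => ?_
  simp only [hF, true_and]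
  push Not
  rfl

theorem faces_addPair_of_mem (h : (u, v) ∈ W) : faces (addPair r u v) W S = faces r W S := by
  ext F
  refine mem_faces_addPair.trans (and_iff_left_of_imp fun hF I hI hv => ?_)
  obtain ⟨J, hJ, huJ, hvJ⟩ := hF.2.2 _ h
  rcases hF.1.total hI hJ with hIJ | hJI
  · exact absurd (hIJ hv) hvJ
  · exact hJI huJ

theorem AcyclicAt.faces_insert [DecidableEq N] (u v : N)
    (h : AcyclicAt Finset.card (faces r W S) i)
    (h' : AcyclicAt Finset.card (faces (addPair r v u) W S) (i - 1)) :
    AcyclicAt Finset.card (faces r (insert (u, v) W) S) i :=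
  h.left_of_isRelUpperSet (isRelUpperSet_faces_insert u v) ordConnected_faces
    injOn_card_of_mem_faces (by rwa [faces_sdiff_faces_insert])

theorem AcyclicAt.of_faces_insert [DecidableEq N] (u v : N)
    (h : AcyclicAt Finset.card (faces r (insert (u, v) W) S) i)
    (h' : AcyclicAt Finset.card (faces (addPair r v u) W S) i) :
    AcyclicAt Finset.card (faces r W S) i :=
  .of_isRelUpperSet (isRelUpperSet_faces_insert u v) ordConnected_faces
    injOn_card_of_mem_faces h (by rwa [faces_sdiff_faces_insert])

section Total

theorem isChain_isPredClosed (hr : Std.Total (ReflTransGen r)) :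
    IsChain (· ⊆ ·) {I : Finset N | IsPredClosed r I} := by
  intro I hI J hJ _
  by_contra hcon
  simp only [not_or, Finset.not_subset] at hcon
  obtain ⟨⟨x, hxI, hxJ⟩, y, hyJ, hyI⟩ := hcon
  rcases hr.total x y with h | h
  · exact hxJ (IsPredClosed.mem_of_reflTransGen hJ h hyJ)
  · exact hyI (IsPredClosed.mem_of_reflTransGen hI h hxI)

variable [Fintype N]

open Classical in
/-- The smallest predecessor-closed set containing `x`. -/
noncomputable def predClosure (r : N → N → Prop) (x : N) : Finset N :=
  Finset.univ.filter fun y => ReflTransGen r y x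

theorem mem_predClosure {x y : N} : y ∈ predClosure r x ↔ ReflTransGen r y x := by
  simp [predClosure]

theorem isPredClosed_predClosure (x : N) : IsPredClosed r (predClosure r x) := by
  simp only [IsPredClosed, mem_predClosure]
  exact fun _ _ hyz hz => hz.head hyz

theorem reflTransGen_of_card_predClosure_le {x y : N} (h : ReflTransGen r x y)
    (hcard : (predClosure r y).card ≤ (predClosure r x).card) : ReflTransGen r y x := by
  have hsub : predClosure r x ⊆ predClosure r y := fun z => by
    simpa only [mem_predClosure] using (·.trans h)
  rw [← mem_predClosure, Finset.eq_of_subset_of_card_le hsub hcard, mem_predClosure]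

theorem numClasses_le_card_image_predClosure (hr : Std.Total (ReflTransGen r)) :
    numClasses r ≤ (Finset.univ.image fun x => (predClosure r x).card).card := by
  have hinj : Function.Injective fun q : Antisymmetrization N (ReflTransGen r) =>
      (⟨(predClosure r q.out).card, Finset.mem_image_of_mem _ (Finset.mem_univ q.out)⟩ :
        Finset.univ.image fun x => (predClosure r x).card) := by
    intro p q hpq
    have hcard : (predClosure r p.out).card = (predClosure r q.out).card :=
      congrArg Subtype.val hpq
    rw [← p.out_eq, ← q.out_eq]
    refine Quotient.sound ?_
    rcases hr.total p.out q.out with h | h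
    · exact ⟨h, reflTransGen_of_card_predClosure_le h hcard.ge⟩
    · exact ⟨reflTransGen_of_card_predClosure_le h hcard.le, h⟩
  simpa only [numClasses, Nat.card_eq_fintype_card, Fintype.card_coe] using
    Nat.card_le_card_of_injective _ hinj

theorem exists_isPredClosed_card_mem (hS : S ⊆ Finset.Icc 1 (Fintype.card N))
    (hr : Std.Total (ReflTransGen r)) (hcard : Fintype.card N < S.card + numClasses r) :
    ∃ I, I.card ∈ S ∧ IsPredClosed r I := by
  have himage : (Finset.univ.image fun x => (predClosure r x).card) ⊆
      Finset.Icc 1 (Fintype.card N) := by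
    refine Finset.image_subset_iff.2 fun x _ => Finset.mem_Icc.2 ⟨?_, Finset.card_le_univ _⟩
    exact Finset.card_pos.2 ⟨x, mem_predClosure.2 .refl⟩
  have hclasses := numClasses_le_card_image_predClosure hr
  obtain ⟨k, hk⟩ := Finset.inter_nonempty_of_card_lt_card_add_card hS himage
    (by rw [Nat.card_Icc]; omega)
  obtain ⟨hkS, hkQ⟩ := Finset.mem_inter.1 hk
  obtain ⟨x, -, rfl⟩ := Finset.mem_image.1 hkQ
  exact ⟨predClosure r x, hkS, isPredClosed_predClosure x⟩

theorem acyclicAt_faces_of_total (hS : S ⊆ Finset.Icc 1 (Fintype.card N))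
    (hr : Std.Total (ReflTransGen r)) (hcard : Fintype.card N < S.card + numClasses r) :
    AcyclicAt Finset.card (faces r ∅ S) i := by
  classical
  set L : Finset (Finset N) := Finset.univ.filter fun I => I.card ∈ S ∧ IsPredClosed r I
  have mem_L {I : Finset N} : I ∈ L ↔ I.card ∈ S ∧ IsPredClosed r I := by simp [L]
  have hchain : IsChain (· ⊆ ·) (L : Set (Finset N)) :=
    (isChain_isPredClosed hr).mono fun I hI => (mem_L.1 hI).2
  have hfaces : faces r ∅ S = Set.Iic L := by
    ext F
    exact ⟨fun hF I hI => mem_L.2 (hF.2.1 I hI), fun hF =>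
      ⟨hchain.mono (Finset.coe_subset.2 hF), fun I hI => mem_L.1 (hF hI), by simp⟩⟩
  obtain ⟨I, hI⟩ := exists_isPredClosed_card_mem hS hr hcard
  rw [hfaces]
  exact acyclicAt_Iic ⟨I, mem_L.2 hI⟩ (injOn_card_of_isChain hchain)

end Total

variable [Fintype N]

open Classical in
/-- The number of pairs that are not related in the preorder generated by `r`; the measure for the
induction that reduces to total preorders. -/
noncomputable def numUnrelated (r : N → N → Prop) : ℕ :=
  (Finset.univ.filter fun p : N × N => ¬ ReflTransGen r p.1 p.2).card

theorem numUnrelated_addPair_lt (h : ¬ ReflTransGen r u v) :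
    numUnrelated (addPair r u v) < numUnrelated r := by
  refine Finset.card_lt_card (Finset.ssubset_iff_of_subset ?_ |>.2 ⟨(u, v), ?_, ?_⟩)
  · intro p hp
    simp only [Finset.mem_filter, Finset.mem_univ, true_and, reflTransGen_addPair, not_or] at hp ⊢
    exact hp.1
  · simpa using h
  · simp [reflTransGen_addPair, ReflTransGen.refl]

theorem acyclicAt_of_neg {V : Type*} {κ : V → ℕ} {X : Set (Finset V)} (hi : i < 0) :
    AcyclicAt κ X i := fun φ hφ _ =>
  ⟨0, Submodule.zero_mem _, by
    rw [map_zero]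
    exact funext fun F => (hφ F fun hF => by have := hF.2; omega).symm⟩

theorem acyclicAt_faces_empty (hS : S ⊆ Finset.Icc 1 (Fintype.card N)) (r : N → N → Prop)
    (hi : i + Fintype.card N < S.card + numClasses r) :
    AcyclicAt Finset.card (faces r ∅ S) i := by
  classical
  induction hk : numUnrelated r using Nat.strong_induction_on generalizing r i with
  | _ k ih =>
    subst hk
    rcases lt_or_ge i 0 with hneg | hnonneg
    · exact acyclicAt_of_neg hneg
    by_cases htotal : Std.Total (ReflTransGen r)
    · exact acyclicAt_faces_of_total hS htotal (by omega)
    obtain ⟨u, v, huv, hvu⟩ : ∃ u v, ¬ ReflTransGen r u v ∧ ¬ ReflTransGen r v u := by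
      by_contra! h
      exact htotal ⟨fun x y => or_iff_not_imp_left.2 (h x y)⟩
    have huv' : ¬ ReflTransGen (addPair r v u) u v := by
      rw [reflTransGen_addPair]
      exact fun h => h.elim huv fun h => huv h.1
    have hlt_vu := numUnrelated_addPair_lt hvu
    have hle_uv := numClasses_le_addPair hvu
    have hle_vu := numClasses_le_addPair huv
    have hle_both := numClasses_addPair_le_addPair_addPair_add_one huv hvu
    -- The faces of `addPair r v u` that separate `v` from `u` are those of `r` that do so.
    have hsep : AcyclicAt Finset.card (faces r (insert (v, u) ∅) S) i := by
      rw [← faces_addPair_of_mem (Finset.mem_insert_self (v, u) ∅)]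
      exact (ih _ hlt_vu _ (by omega) rfl).faces_insert v u
        (ih _ ((numUnrelated_addPair_lt huv').trans hlt_vu) _ (by omega) rfl)
    exact hsep.of_faces_insert v u (ih _ (numUnrelated_addPair_lt huv) _ (by omega) rfl)

theorem acyclicAt_faces (hS : S ⊆ Finset.Icc 1 (Fintype.card N)) (r : N → N → Prop)
    (W : Finset (N × N))
    (h : ∀ A ⊆ W, A.card ≤ i →
      i + Fintype.card N < S.card + (numClasses (addReverse r A) + A.card)) :
    AcyclicAt Finset.card (faces r W S) i := by
  classical
  induction W using Finset.induction_on generalizing r i with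
  | empty =>
    rcases lt_or_ge i 0 with hneg | hnonneg
    · exact acyclicAt_of_neg hneg
    · refine acyclicAt_faces_empty hS r ?_
      simpa [addReverse_empty] using h ∅ subset_rfl (by simpa using hnonneg)
  | insert p W _ ih =>
    obtain ⟨u, v⟩ := p
    refine (ih r fun A hA => h A (hA.trans (Finset.subset_insert _ _))).faces_insert u v
      (ih (addPair r v u) fun A hA hAi => ?_)
    have hle := Finset.card_insert_le (u, v) A
    have hins := h (insert (u, v) A) (Finset.insert_subset_insert _ hA) (by omega)
    rw [addReverse_insert] at hins
    omega

end Faces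

/-! ### Mixed cycles -/

section Paths

open Relation

theorem exists_nodup_isChain_of_reflTransGen {α : Type*} {r : α → α → Prop} {a b : α}
    (h : ReflTransGen r a b) :
    ∃ l : List α, (a :: l).IsChain r ∧ (a :: l).Nodup ∧
      (a :: l).getLast (List.cons_ne_nil _ _) = b := by
  induction h using ReflTransGen.head_induction_on with
  | refl => exact ⟨[], List.isChain_singleton _, List.nodup_singleton _, rfl⟩
  | @head a c hac _ ih =>
    obtain ⟨l, hchain, hnodup, hlast⟩ := ih
    by_cases ha : a ∈ c :: l
    · obtain ⟨s, t, hst⟩ := List.append_of_mem ha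
      simp only [hst] at hchain hnodup hlast
      refine ⟨t, hchain.suffix (List.suffix_append _ _), hnodup.of_append_right, ?_⟩
      rw [← hlast, List.getLast_append_of_ne_nil]
    · refine ⟨c :: l, List.isChain_cons_cons.2 ⟨hac, hchain⟩, List.nodup_cons.2 ⟨ha, hnodup⟩, ?_⟩
      rwa [List.getLast_cons (List.cons_ne_nil _ _)]

theorem reflTransGen_avoiding_of_between {α : Type*} {r : α → α → Prop} {u v x : α}
    (hux : ReflTransGen r u x) (hxv : ReflTransGen r x v)
    (hu : ¬ AntisymmRel (ReflTransGen r) x u) (hv : ¬ AntisymmRel (ReflTransGen r) x v) :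
    ReflTransGen (fun a b => r a b ∧ ¬ (a = u ∧ b = v)) u v := by
  set r' : α → α → Prop := fun a b => r a b ∧ ¬ (a = u ∧ b = v)
  have r_le : r ≤ addPair r' u v := fun a b hab =>
    (em (a = u ∧ b = v)).elim Or.inr fun h => Or.inl ⟨hab, h⟩
  have r'_le : ReflTransGen r' ≤ ReflTransGen r := ReflTransGen.mono fun _ _ h => h.1
  have hux' : ReflTransGen r' u x := by
    refine (reflTransGen_addPair.1 (ReflTransGen.mono r_le _ _ hux)).resolve_right fun h => ?_
    exact hv ⟨hxv, r'_le _ _ h.2⟩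
  have hxv' : ReflTransGen r' x v := by
    refine (reflTransGen_addPair.1 (ReflTransGen.mono r_le _ _ hxv)).resolve_right fun h => ?_
    exact hu ⟨r'_le _ _ h.1, hux⟩
  exact hux'.trans hxv'

end Paths

namespace MixedGraph

open Relation

variable {V : Type*} [Fintype V] {Γ : MixedGraph V}

theorem m_le_of_isMixedCycle {k : ℕ} {w : Fin (k + 3) → V} {E : Finset (Fin (k + 3))}
    (h : Γ.IsMixedCycle w E) : Γ.m ≤ E.card := by
  have hmem : E.card ∈ Γ.mixedCycleCounts := ⟨k, w, E, h, rfl⟩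
  rw [m, if_pos ⟨_, hmem⟩]
  exact Nat.sInf_le hmem

open Classical in
/-- The pairs `(u, v)` joined by a directed and by an undirected edge, that is, the pairs along
which weak colorings increase strictly. -/
noncomputable def strictPairs (Γ : MixedGraph V) : Finset (V × V) :=
  Finset.univ.filter fun p => Γ.directed.Adj p.1 p.2 ∧ Γ.undirected.Adj p.1 p.2

theorem mem_strictPairs {p : V × V} :
    p ∈ Γ.strictPairs ↔ Γ.directed.Adj p.1 p.2 ∧ Γ.undirected.Adj p.1 p.2 := by
  simp [strictPairs]

variable {A : Finset (V × V)}

/-- The path is closed to a mixed cycle, whose undirected edges are the closing edge and the steps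
of the path that are reversed pairs from `A`. -/
theorem m_le_card_add_one_of_isChain (hA : A ⊆ Γ.strictPairs) {a b c : V} {l : List V}
    (hchain : (a :: b :: c :: l).IsChain (addReverse Γ.directed.Adj A))
    (hnodup : (a :: b :: c :: l).Nodup)
    (hclose : Γ.undirected.Adj ((a :: b :: c :: l).getLast (List.cons_ne_nil _ _)) a)
    (hdirected : ¬ (a :: b :: c :: l).IsChain (Function.swap Γ.directed.Adj)) :
    Γ.m ≤ A.card + 1 := by
  classical
  let w : Fin (l.length + 3) → V := (a :: b :: c :: l).get
  have hw : Function.Injective w := List.nodup_iff_injective_get.1 hnodup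
  have step (j : Fin (l.length + 2)) :
      addReverse Γ.directed.Adj A (w j.castSucc) (w j.succ) :=
    List.isChain_iff_getElem.1 hchain j (by simp only [List.length_cons]; omega)
  let reversed : Finset (Fin (l.length + 2)) :=
    Finset.univ.filter fun j => (w j.succ, w j.castSucc) ∈ A
  have mem_reversed {j} : j ∈ reversed ↔ (w j.succ, w j.castSucc) ∈ A := by simp [reversed]
  have hreversed : reversed.card ≤ A.card :=
    Finset.card_le_card_of_injOn (fun j => (w j.succ, w j.castSucc)) (fun j => mem_reversed.1)
      fun i _ j _ hij => Fin.castSucc_injective _ (hw (congrArg Prod.snd hij))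
  let E := insert (Fin.last _) (reversed.map Fin.castSuccEmb)
  have mem_E {j : Fin (l.length + 2)} : j.castSucc ∈ E ↔ j ∈ reversed := by
    simp [E, Fin.castSucc_ne_last]
  suffices hcycle : Γ.IsMixedCycle w E by
    refine (m_le_of_isMixedCycle hcycle).trans ((Finset.card_insert_le _ _).trans ?_)
    rwa [Finset.card_map, add_le_add_iff_right]
  refine ⟨hw, fun i hi => ?_, fun i hi => ?_, ?_⟩
  · rcases i.eq_castSucc_or_eq_last with ⟨j, rfl⟩ | rfl
    · rw [Fin.coeSucc_eq_succ]
      exact (mem_strictPairs.1 (hA (mem_reversed.1 (mem_E.1 hi)))).2.symm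
    · rw [Fin.last_add_one]
      rwa [List.getLast_eq_getElem] at hclose
  · rcases i.eq_castSucc_or_eq_last with ⟨j, rfl⟩ | rfl
    · rw [Fin.coeSucc_eq_succ]
      exact (step j).resolve_right fun h => hi (mem_E.2 (mem_reversed.2 h))
    · exact absurd (Finset.mem_insert_self _ _) hi
  · by_contra! hall
    refine hdirected (List.isChain_iff_getElem.2 fun j hj => ?_)
    have hj' : j < l.length + 2 := by simp only [List.length_cons] at hj; omega
    exact (mem_strictPairs.1 (hA (mem_reversed.1 (mem_E.1 (hall (Fin.castSucc ⟨j, hj'⟩)))))).1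

theorem m_le_card_add_one_of_between (hΓ : Std.Antisymm (ReflTransGen Γ.directed.Adj))
    (hA : A ⊆ Γ.strictPairs) {u v x : V} (huv : (u, v) ∈ Γ.strictPairs)
    (hux : ReflTransGen (addReverse Γ.directed.Adj A) u x)
    (hxv : ReflTransGen (addReverse Γ.directed.Adj A) x v)
    (hu : ¬ AntisymmRel (ReflTransGen (addReverse Γ.directed.Adj A)) x u)
    (hv : ¬ AntisymmRel (ReflTransGen (addReverse Γ.directed.Adj A)) x v) :
    Γ.m ≤ A.card + 1 := by
  obtain ⟨huv_dir, huv_undir⟩ := mem_strictPairs.1 huv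
  obtain ⟨l, hchain, hnodup, hlast⟩ := exists_nodup_isChain_of_reflTransGen
    (reflTransGen_avoiding_of_between hux hxv hu hv)
  match l with
  | [] => exact absurd hlast huv_undir.ne
  | [_] => exact absurd ⟨rfl, hlast⟩ (List.isChain_pair.1 hchain).2
  | b :: c :: l =>
    refine m_le_card_add_one_of_isChain hA (hchain.imp fun _ _ h => h.1) hnodup
      (hlast ▸ huv_undir.symm) fun hback => huv_undir.ne ?_
    exact hΓ.antisymm u v (.single huv_dir) <|
      reflTransGen_swap.1 (List.relationReflTransGen_of_exists_isChain_cons _ hback hlast)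

theorem card_le_numClasses_addReverse_add_card
    (hΓ : Std.Antisymm (ReflTransGen Γ.directed.Adj)) (hA : A ⊆ Γ.strictPairs)
    (hm : A.card < Γ.m) :
    Fintype.card V ≤ numClasses (addReverse Γ.directed.Adj A) + A.card := by
  classical
  induction A using Finset.induction_on with
  | empty => simpa [addReverse_empty] using card_le_numClasses_of_antisymm hΓ
  | insert p A hp ih =>
    obtain ⟨u, v⟩ := p
    obtain ⟨huv, hA⟩ := Finset.insert_subset_iff.1 hA
    rw [Finset.card_insert_of_notMem hp] at hm ⊢
    rw [addReverse_insert']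
    have hloss := numClasses_le_addPair_add_one (r := addReverse Γ.directed.Adj A)
      (u := u) (v := v) fun x hux hxv => by
        by_contra! hx
        exact hm.not_ge (m_le_card_add_one_of_between hΓ hA huv hux hxv hx.1 hx.2)
    have := ih hA (Nat.lt_of_succ_lt hm)
    omega

end MixedGraph

/-! ### Characters of exact complexes -/

section Characters

open LinearMap

theorem trace_eq_add_of_exact {K A V B : Type*} [Field K] [AddCommGroup A] [Module K A]
    [FiniteDimensional K A] [AddCommGroup V] [Module K V] [FiniteDimensional K V]
    [AddCommGroup B] [Module K B] [FiniteDimensional K B] {ι : A →ₗ[K] V} {π : V →ₗ[K] B}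
    (hι : Function.Injective ι) (hπ : Function.Surjective π) (hex : Function.Exact ι π)
    {fA : A →ₗ[K] A} {fV : V →ₗ[K] V} {fB : B →ₗ[K] B} (hA : ι ∘ₗ fA = fV ∘ₗ ι)
    (hB : π ∘ₗ fV = fB ∘ₗ π) : trace K V fV = trace K A fA + trace K B fB := by
  obtain ⟨q, hq⟩ := ι.exists_leftInverse_of_injective (ker_eq_bot.2 hι)
  obtain ⟨e, hιe, hπe⟩ := hex.splitInjectiveEquiv hπ ⟨q, hq⟩
  set r := fst K A B ∘ₗ e.toLinearMap with hr
  set s := e.symm.toLinearMap ∘ₗ inr K A B with hs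
  have hrι : r ∘ₗ ι = LinearMap.id := by ext a; simp [hr, hιe]
  have hπs : π ∘ₗ s = LinearMap.id := by ext b; simp [hs, hπe]
  have hid : ι ∘ₗ r + s ∘ₗ π = LinearMap.id := by
    ext x
    apply e.injective
    simp [hr, hs, hιe, hπe]
  calc trace K V fV = trace K V ((fV ∘ₗ ι) ∘ₗ r + (fV ∘ₗ s) ∘ₗ π) := by
        rw [comp_assoc, comp_assoc, ← comp_add, hid, comp_id]
    _ = trace K A ((r ∘ₗ ι) ∘ₗ fA) + trace K B (fB ∘ₗ π ∘ₗ s) := by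
        rw [map_add, trace_comp_comm' r, trace_comp_comm' π, ← hA,
          ← comp_assoc, ← comp_assoc _ fV, hB, comp_assoc s]
    _ = trace K A fA + trace K B fB := by rw [hrι, hπs, id_comp, comp_id]

variable {G M : Type*} [Group G] [AddCommGroup M] [Module ℂ M] [FiniteDimensional ℂ M]

theorem isEffectiveCharacter_character (ρ : Representation ℂ G M) :
    IsEffectiveCharacter ρ.character := by
  let e : M ≃ₗ[ℂ] (Fin (Module.finrank ℂ M) → ℂ) := (Module.finBasis ℂ M).equivFun
  refine ⟨_, e.conjRingEquiv.toMonoidHom.comp ρ, funext fun g => ?_⟩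
  exact (trace_conj' (ρ g) e).symm

variable (ρ : Representation ℂ G M) {B C D : Submodule ℂ M}

theorem character_eq_add_quotient (hBC : B ≤ C) (hB : ∀ g, B ≤ B.comap (ρ g))
    (hC : ∀ g, C ≤ C.comap (ρ g)) :
    (ρ.subrepresentation C hC).character = (ρ.subrepresentation B hB).character +
      ((ρ.subrepresentation C hC).quotient (B.submoduleOf C) fun g _ hφ => hB g hφ).character := by
  funext g
  refine trace_eq_add_of_exact (ι := Submodule.inclusion hBC) (π := (B.submoduleOf C).mkQ)
    (Submodule.inclusion_injective _) (Submodule.mkQ_surjective _) ?_ rfl rfl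
  rw [exact_iff, Submodule.ker_mkQ, Submodule.range_inclusion]
  rfl

theorem character_eq_add_map (hBC : B ≤ C) {δ : M →ₗ[ℂ] M} (hδ : ∀ g φ, δ (ρ g φ) = ρ g (δ φ))
    (hker : ∀ φ ∈ C, δ φ = 0 ↔ φ ∈ B) (hD : C.map δ = D) (hB : ∀ g, B ≤ B.comap (ρ g))
    (hC : ∀ g, C ≤ C.comap (ρ g)) (hD' : ∀ g, D ≤ D.comap (ρ g)) :
    (ρ.subrepresentation C hC).character =
      (ρ.subrepresentation B hB).character + (ρ.subrepresentation D hD').character := by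
  subst hD
  funext g
  refine trace_eq_add_of_exact (ι := Submodule.inclusion hBC)
    (π := δ.restrict fun _ => Submodule.mem_map_of_mem) (Submodule.inclusion_injective _) ?_ ?_
    rfl (LinearMap.ext fun φ => Subtype.ext (hδ g φ))
  · rintro ⟨_, φ, hφ, rfl⟩
    exact ⟨⟨φ, hφ⟩, rfl⟩
  · rintro ⟨φ, hφ⟩
    rw [← coe_range, Submodule.range_inclusion, Subtype.ext_iff]
    exact hker φ hφ

theorem sum_range_succ_neg_one_pow_mul_of_eq_add {R : Type*} [CommRing R] {b c : ℕ → R} {k : ℕ}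
    (hb : b 0 = 0) (hc : ∀ i < k, c i = b i + b (i + 1)) :
    ∑ i ∈ Finset.range (k + 1), (-1) ^ (k + i) * c i = c k - b k := by
  induction k with
  | zero => simp [hb]
  | succ k ih =>
    have hsucc : ∑ i ∈ Finset.range (k + 1), (-1) ^ (k + 1 + i) * c i =
        -∑ i ∈ Finset.range (k + 1), (-1) ^ (k + i) * c i := by
      rw [← Finset.sum_neg_distrib]
      exact Finset.sum_congr rfl fun i _ => by ring
    rw [Finset.sum_range_succ, hsucc, ih fun i hi => hc i (by lia), hc k k.lt_succ_self,
      Even.neg_one_pow ⟨k + 1, rfl⟩]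
    ring

/-- The alternating sum is the character of the cohomology in the top degree `k`, since the lower
cohomology vanishes. -/
theorem isEffectiveCharacter_of_exact (C : ℤ → Submodule ℂ M) (hC : ∀ i g, C i ≤ (C i).comap (ρ g))
    (hC₀ : C (-1) = ⊥) {δ : M →ₗ[ℂ] M} (hδ : ∀ g φ, δ (ρ g φ) = ρ g (δ φ))
    (hδC : ∀ i, ∀ φ ∈ C (i - 1), δ φ ∈ C i) (hδδ : ∀ i, ∀ φ ∈ C i, δ (δ φ) = 0) {k : ℕ}
    (hex : ∀ i : ℕ, i < k → ∀ φ ∈ C i, δ φ = 0 → ∃ ψ ∈ C (i - 1), δ ψ = φ) :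
    IsEffectiveCharacter fun g => ∑ i ∈ Finset.range (k + 1),
      (-1) ^ (k + i) * (ρ.subrepresentation (C i) (hC i)).character g := by
  let B (i : ℕ) : Submodule ℂ M := (C (i - 1)).map δ
  have hB : ∀ i g, B i ≤ (B i).comap (ρ g) := by
    rintro i g _ ⟨φ, hφ, rfl⟩
    exact ⟨ρ g φ, hC _ g hφ, hδ g φ⟩
  have hBC (i : ℕ) : B i ≤ C i := Submodule.map_le_iff_le_comap.2 (hδC i)
  have hker (i : ℕ) (hi : i < k) (φ) (hφ : φ ∈ C i) : δ φ = 0 ↔ φ ∈ B i := by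
    refine ⟨hex i hi φ hφ, ?_⟩
    rintro ⟨ψ, hψ, rfl⟩
    exact hδδ _ ψ hψ
  have hsum (g : G) := sum_range_succ_neg_one_pow_mul_of_eq_add (k := k)
    (b := fun i => (ρ.subrepresentation (B i) (hB i)).character g)
    (c := fun i => (ρ.subrepresentation (C i) (hC i)).character g) ?_ fun i hi => ?_
  · convert isEffectiveCharacter_character ((ρ.subrepresentation (C k) (hC k)).quotient
      ((B k).submoduleOf (C k)) fun g _ hφ => hB k g hφ) using 1
    funext g
    rw [hsum, character_eq_add_quotient ρ (hBC k) (hB k) (hC k), Pi.add_apply, add_sub_cancel_left]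
  · have : Subsingleton (B 0) := by
      have : B 0 = ⊥ := by simp [B, hC₀]
      rw [this]
      infer_instance
    rw [Representation.character, Subsingleton.elim (ρ.subrepresentation (B 0) (hB 0) g) 0,
      map_zero]
  · have hBsucc : (C i).map δ = B (i + 1) := by simp [B]
    exact congrFun (character_eq_add_map ρ (hBC i) hδ (hker i hi) hBsucc _ _ _) g

end Characters

section FunctionRep

variable (G Y : Type*) [Group G] [MulAction G Y]

/-- The representation of `G` on the functions on a `G`-set. -/
def functionRep : Representation ℂ G (Y → ℂ) where
  toFun g := LinearMap.funLeft ℂ ℂ fun y => g⁻¹ • y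
  map_one' := by
    ext φ y
    simp [LinearMap.funLeft_apply]
  map_mul' g h := by
    ext φ y
    simp [LinearMap.funLeft_apply, mul_smul]

variable {G Y}

theorem functionRep_apply (g : G) (φ : Y → ℂ) (y : Y) :
    functionRep G Y g φ y = φ (g⁻¹ • y) := rfl

theorem supportedOn_le_comap_functionRep {P : Set Y} (hP : ∀ (g : G), ∀ y ∈ P, g • y ∈ P) (g : G) :
    supportedOn P ≤ (supportedOn P).comap (functionRep G Y g) := fun _ hφ y hy =>
  hφ _ fun h => hy (by simpa using hP g _ h)

open Classical in
theorem character_supportedOn [Fintype Y] {P : Set Y}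
    (hP : ∀ (g : G), ∀ y ∈ P, g • y ∈ P) (g : G) :
    ((functionRep G Y).subrepresentation (supportedOn P)
      (supportedOn_le_comap_functionRep hP)).character g =
        (Finset.card {y | y ∈ P ∧ g • y = y} : ℂ) := by
  let f : (Y → ℂ) →ₗ[ℂ] (Y → ℂ) :=
    LinearMap.pi fun y => if y ∈ P then LinearMap.proj (g⁻¹ • y) else 0
  have hf : ∀ φ ∈ supportedOn P, f φ = functionRep G Y g φ := fun φ hφ => funext fun y => by
    by_cases hy : y ∈ P
    · simp [f, hy, functionRep_apply]
    · simp [f, hy, mem_supportedOn.1 (supportedOn_le_comap_functionRep hP g hφ) y hy]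
  have hfP (φ) : f φ ∈ supportedOn P := fun y (hy : y ∉ P) => by simp [f, hy]
  have hrestrict : (functionRep G Y).subrepresentation (supportedOn P)
      (supportedOn_le_comap_functionRep hP) g = f.restrict fun φ _ => hfP φ :=
    LinearMap.ext fun φ => Subtype.ext (hf φ φ.2).symm
  rw [Representation.character, hrestrict, LinearMap.trace_restrict_eq_of_forall_mem _ f hfP,
    LinearMap.trace_eq_matrix_trace ℂ (Pi.basisFun ℂ Y), Matrix.trace, Finset.card_filter,
    Nat.cast_sum]
  refine Finset.sum_congr rfl fun y _ => ?_
  by_cases hy : y ∈ P <;> simp [f, hy, Pi.single_apply, inv_smul_eq_iff, eq_comm (a := y)]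

end FunctionRep

section InvariantFaces

open scoped Pointwise

theorem sum_neg_one_pow_add_card {R V : Type*} [CommRing R] {A : Finset (Finset V)} {k : ℕ}
    (hA : ∀ F ∈ A, F.card ≤ k) : ∑ F ∈ A, (-1 : R) ^ (k + F.card) =
      ∑ i ∈ Finset.range (k + 1), (-1) ^ (k + i) * ((A.filter (·.card = i)).card : R) := by
  rw [← Finset.sum_fiberwise_of_maps_to fun F hF => Finset.mem_range_succ_iff.2 (hA F hF)]
  refine Finset.sum_congr rfl fun i _ => ?_
  rw [mul_comm, ← nsmul_eq_mul, ← Finset.sum_const]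
  exact Finset.sum_congr rfl fun F hF => by rw [(Finset.mem_filter.1 hF).2]

variable {G V : Type*} [Group G] [MulAction G V] [DecidableEq V] {κ : V → ℕ} {X : Set (Finset V)}

theorem incidence_smul (hκ : ∀ (g : G) v, κ (g • v) = κ v) (g : G) (F : Finset V) (I : V) :
    incidence κ (g • F) (g • I) = incidence κ F I := by
  classical
  rw [incidence, incidence, Finset.smul_finset_def, Finset.filter_image]
  simp only [hκ]
  rw [Finset.card_image_of_injective _ (MulAction.injective g)]

theorem coboundary_functionRep (hXG : ∀ (g : G), ∀ F ∈ X, g • F ∈ X)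
    (hκ : ∀ (g : G) v, κ (g • v) = κ v) (g : G) (φ : Finset V → ℂ) :
    coboundary κ X (functionRep G (Finset V) g φ) =
      functionRep G (Finset V) g (coboundary κ X φ) := by
  funext F
  rw [functionRep_apply]
  by_cases hF : F ∈ X
  · rw [coboundary_apply_of_mem _ hF, coboundary_apply_of_mem _ (hXG g⁻¹ F hF),
      Finset.smul_finset_def, Finset.sum_image (MulAction.injective _).injOn]
    refine Finset.sum_congr rfl fun I _ => ?_
    rw [functionRep_apply, ← incidence_smul hκ g⁻¹ F I, Finset.smul_finset_def,
      Finset.smul_finset_def, Finset.image_erase (MulAction.injective _)]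
  · rw [coboundary_apply_of_notMem _ hF, coboundary_apply_of_notMem]
    exact fun h => hF (by simpa using hXG g _ h)

open Classical in
theorem isEffectiveCharacter_sum_fixedFaces [Fintype V] (hX : X.OrdConnected)
    (hXκ : ∀ F ∈ X, Set.InjOn κ F) (hXG : ∀ (g : G), ∀ F ∈ X, g • F ∈ X)
    (hκ : ∀ (g : G) v, κ (g • v) = κ v) {k : ℕ} (hXk : ∀ F ∈ X, F.card ≤ k)
    (hac : ∀ i : ℕ, i < k → AcyclicAt κ X i) :
    IsEffectiveCharacter fun g : G => ∑ F with F ∈ X ∧ g • F = F, (-1) ^ (k + F.card) := by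
  have hXi (i : ℤ) (g : G) (F) (hF : F ∈ {F ∈ X | (F.card : ℤ) = i}) :
      g • F ∈ {F ∈ X | (F.card : ℤ) = i} :=
    ⟨hXG g F hF.1, by rw [Finset.card_smul_finset, hF.2]⟩
  have hC (i : ℤ) : ∀ g, cochains X i ≤ (cochains X i).comap (functionRep G (Finset V) g) :=
    supportedOn_le_comap_functionRep (hXi i)
  have hC₀ : cochains X (-1) = ⊥ :=
    (Submodule.eq_bot_iff _).2 fun φ hφ => funext fun F => hφ F fun ⟨_, hF⟩ => by lia
  have hchar (g : G) : ∑ F with F ∈ X ∧ g • F = F, (-1) ^ (k + F.card) =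
      ∑ i ∈ Finset.range (k + 1), (-1) ^ (k + i) *
        ((functionRep G (Finset V)).subrepresentation (cochains X i) (hC i)).character g := by
    rw [sum_neg_one_pow_add_card fun F hF => hXk F (Finset.mem_filter.1 hF).2.1]
    refine Finset.sum_congr rfl fun i _ => congrArg _ ?_
    refine Eq.trans ?_ (character_supportedOn (hXi i) g).symm
    congr 2
    ext F
    simp only [Finset.mem_filter, Set.mem_ofPred_eq, Nat.cast_inj]
    tauto
  simp_rw [hchar]
  exact isEffectiveCharacter_of_exact (functionRep G (Finset V)) (cochains X) hC hC₀
    (coboundary_functionRep hXG hκ) (fun i φ hφ => coboundary_mem_cochains hφ)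
    (fun i φ hφ => coboundary_coboundary hX hXκ (cochains_le_supportedOn hφ)) hac

end InvariantFaces

/-! ### Möbius inversion over finite sets -/

section Moebius

variable {α R : Type*} [CommRing R]

theorem sum_Icc_neg_one_pow_card_eq_zero [DecidableEq α] {U S : Finset α} (h : U ⊂ S) :
    ∑ T ∈ Finset.Icc U S, (-1 : R) ^ T.card = 0 := by
  obtain ⟨a, haS, haU⟩ := Finset.exists_of_ssubset h
  refine Finset.sum_involution (fun T _ => if a ∈ T then T.erase a else insert a T) ?_ ?_ ?_ ?_
  · intro T _
    split_ifs with ha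
    · rw [← Finset.card_erase_add_one ha, pow_succ]
      ring
    · rw [Finset.card_insert_of_notMem ha, pow_succ]
      ring
  · intro T _ _
    split_ifs with ha
    · exact (Finset.erase_ne_self.2 ha)
    · exact (Finset.insert_ne_self.2 ha)
  · intro T hT
    rw [Finset.mem_Icc] at hT ⊢
    split_ifs with ha
    · exact ⟨Finset.subset_erase.2 ⟨hT.1, haU⟩, (Finset.erase_subset _ _).trans hT.2⟩
    · exact ⟨hT.1.trans (Finset.subset_insert _ _), Finset.insert_subset haS hT.2⟩
  · intro T _
    split_ifs <;> simp_all

theorem sum_powerset_neg_one_pow_mul_sum_powerset (a : Finset α → R) (S : Finset α) :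
    ∑ T ∈ S.powerset, (-1) ^ T.card * ∑ U ∈ T.powerset, (-1) ^ U.card * a U = a S := by
  classical
  calc ∑ T ∈ S.powerset, (-1) ^ T.card * ∑ U ∈ T.powerset, (-1) ^ U.card * a U
      = ∑ U ∈ S.powerset, ∑ T ∈ Finset.Icc U S, (-1) ^ T.card * ((-1) ^ U.card * a U) := by
        simp_rw [Finset.mul_sum]
        refine Finset.sum_comm' fun T U => ?_
        simp only [Finset.mem_powerset, Finset.mem_Icc]
        exact ⟨fun h => ⟨⟨h.2, h.1⟩, h.2.trans h.1⟩, fun h => ⟨h.1.2, h.1.1⟩⟩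
    _ = ∑ T ∈ Finset.Icc S S, (-1) ^ T.card * ((-1) ^ S.card * a S) := by
        refine Finset.sum_eq_single_of_mem S (Finset.mem_powerset_self S) fun U hU hne => ?_
        rw [← Finset.sum_mul, sum_Icc_neg_one_pow_card_eq_zero
          ((Finset.mem_powerset.1 hU).ssubset_of_ne hne), zero_mul]
    _ = a S := by
        rw [Finset.Icc_self, Finset.sum_singleton, ← mul_assoc, ← pow_add,
          Even.neg_one_pow ⟨_, rfl⟩, one_mul]

theorem sum_powerset_eq_iff {c a : Finset α → R} :
    (∀ T, ∑ S ∈ T.powerset, c S = a T) ↔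
      ∀ S, c S = ∑ T ∈ S.powerset, (-1) ^ (S.card + T.card) * a T := by
  have hsq (S : Finset α) (x : R) : (-1) ^ S.card * ((-1) ^ S.card * x) = x := by
    rw [← mul_assoc, ← pow_add, Even.neg_one_pow ⟨_, rfl⟩, one_mul]
  simp_rw [pow_add, mul_assoc, ← Finset.mul_sum]
  constructor
  · intro h S
    calc c S = (-1) ^ S.card * ∑ T ∈ S.powerset, (-1) ^ T.card *
          ∑ U ∈ T.powerset, (-1) ^ U.card * ((-1) ^ U.card * c U) := by
            rw [sum_powerset_neg_one_pow_mul_sum_powerset, hsq]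
      _ = _ := by simp_rw [hsq, h]
  · intro h T
    simp_rw [h]
    exact sum_powerset_neg_one_pow_mul_sum_powerset a T

end Moebius

/-! ### Coefficients of quasisymmetric functions -/

section Coefficients

/-- The exponent of `x_0 ⋯ x_{m-1}` in the monomial `d`. -/
def prefixSum (d : ℕ →₀ ℕ) (m : ℕ) : ℕ := ∑ l ∈ Finset.range m, d l

open Classical in
/-- The subset of `[n-1]` given by the proper partial sums of the exponents of `d`; as in
`subsetComposition`, the element `s : Fin (n - 1)` stands for `s + 1 ∈ [n-1]`. -/
noncomputable def prefixSet (n : ℕ) (d : ℕ →₀ ℕ) : Finset (Fin (n - 1)) :=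
  {s | ∃ m, prefixSum d m = s + 1}

theorem mem_prefixSet {n : ℕ} {d : ℕ →₀ ℕ} {s : Fin (n - 1)} :
    s ∈ prefixSet n d ↔ ∃ m, prefixSum d m = s + 1 := by
  simp [prefixSet]

/-- The sequence `i` contributes the monomial `d = ∏_j x_{i_j}^{c_j}` to the monomial
quasisymmetric function of the composition `c`. -/
def IsMonomialSeq {n : ℕ} (c : Composition n) (d : ℕ →₀ ℕ) (i : Fin c.length → ℕ) : Prop :=
  StrictMono i ∧ ∑ j, Finsupp.single (i j) (c.blocksFun j) = d

namespace IsMonomialSeq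

variable {n : ℕ} {c : Composition n} {d : ℕ →₀ ℕ} {i i' : Fin c.length → ℕ}

theorem degree_eq (h : IsMonomialSeq c d i) : d.degree = n := by
  simp [← h.2]

theorem range_eq_support (h : IsMonomialSeq c d i) : Set.range i = d.support := by
  ext l
  simp only [← h.2, Set.mem_range, Finset.mem_coe, Finsupp.mem_support_iff,
    Finsupp.finsetSum_apply, ne_eq, Finset.sum_eq_zero_iff, Finset.mem_univ, true_imp_iff,
    not_forall, Finsupp.single_apply_eq_zero]
  exact exists_congr fun j => ⟨fun hj => ⟨hj.symm, Nat.ne_zero_of_lt (c.one_le_blocksFun j)⟩,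
    fun ⟨hj, _⟩ => hj.symm⟩

theorem unique (h : IsMonomialSeq c d i) (h' : IsMonomialSeq c d i') : i = i' :=
  (h.1.range_inj h'.1).1 (h.range_eq_support.trans h'.range_eq_support.symm)

theorem prefixSum_eq_sizeUpTo (h : IsMonomialSeq c d i) {m k : ℕ} (hmk : ∀ j, i j < m ↔ j < k) :
    prefixSum d m = c.sizeUpTo k := by
  rw [Composition.sizeUpTo, ← c.ofFn_blocksFun, List.sum_take_ofFn, prefixSum, ← h.2]
  simp_rw [Finsupp.finsetSum_apply, ← hmk, Finset.sum_filter]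
  rw [Finset.sum_comm]
  simp [Finsupp.single_apply]

theorem exists_lt_iff_lt (h : IsMonomialSeq c d i) (m : ℕ) :
    ∃ k ≤ c.length, ∀ j, i j < m ↔ j < k := by
  have hlower : IsLowerSet {j | i j < m} := fun j k hkj hj => (h.1.monotone hkj).trans_lt hj
  obtain huniv | ⟨k, hk⟩ := hlower.eq_univ_or_Iio
  · exact ⟨c.length, le_rfl, fun j => by simpa using Set.ext_iff.1 huniv j⟩
  · exact ⟨k, k.2.le, fun j => Set.ext_iff.1 hk j⟩

theorem exists_prefixSum_eq_iff (h : IsMonomialSeq c d i) {x : ℕ} (hx : x < n) :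
    (∃ m, prefixSum d m = x) ↔ ∃ j ≤ c.length, c.sizeUpTo j = x := by
  constructor
  · rintro ⟨m, rfl⟩
    obtain ⟨k, hk, hmk⟩ := h.exists_lt_iff_lt m
    exact ⟨k, hk, (h.prefixSum_eq_sizeUpTo hmk).symm⟩
  · rintro ⟨j, hj, rfl⟩
    have hj : j < c.length := hj.lt_of_ne fun h => by simp [h] at hx
    exact ⟨i ⟨j, hj⟩, h.prefixSum_eq_sizeUpTo fun k => h.1.lt_iff_lt⟩

end IsMonomialSeq

theorem exists_isMonomialSeq (d : ℕ →₀ ℕ) :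
    ∃ (c : Composition d.degree) (i : Fin c.length → ℕ), IsMonomialSeq c d i := by
  let e := d.support.orderEmbOfFin rfl
  have hsum {M : Type} [AddCommMonoid M] (f : ℕ → M) : ∑ j, f (e j) = ∑ l ∈ d.support, f l := by
    rw [← d.support.sum_coe_sort]
    exact (d.support.orderIsoOfFin rfl).toEquiv.sum_comp fun l => f l
  let c : Composition d.degree :=
    { blocks := List.ofFn fun j => d (e j)
      blocks_pos := fun h => by
        obtain ⟨j, rfl⟩ := List.mem_ofFn.1 h
        exact Nat.pos_of_ne_zero (Finsupp.mem_support_iff.1 (d.support.orderEmbOfFin_mem rfl j))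
      blocks_sum := by rw [List.sum_ofFn, hsum, Finsupp.degree_apply] }
  have hc : c.length = d.support.card := List.length_ofFn
  refine ⟨c, fun j => e (Fin.cast hc j), fun j k hjk => e.strictMono hjk, ?_⟩
  have hblocks (j : Fin c.length) : c.blocksFun j = d (e (Fin.cast hc j)) := List.get_ofFn _ _
  calc ∑ j, Finsupp.single (e (Fin.cast hc j)) (c.blocksFun j)
      = ∑ j, Finsupp.single (e (finCongr hc j)) (d (e (finCongr hc j))) := by
        simp only [hblocks, finCongr_apply]
    _ = ∑ l ∈ d.support, Finsupp.single l (d l) := by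
        rw [(finCongr hc).sum_comp fun j => Finsupp.single (e j) (d (e j)),
          hsum fun l => Finsupp.single l (d l)]
    _ = d := d.sum_single

variable {n : ℕ} {T : Finset (Fin (n - 1))} {d : ℕ →₀ ℕ}

theorem mem_iff_exists_sizeUpTo_subsetComposition {s : Fin (n - 1)} :
    s ∈ T ↔ ∃ j ≤ (subsetComposition n T).length, (subsetComposition n T).sizeUpTo j = s + 1 := by
  have hmem : s ∈ T ↔
      (⟨s + 1, by lia⟩ : Fin (n + 1)) ∈ (subsetComposition n T).boundaries := by
    conv_lhs => rw [← (compositionAsSetEquiv n).apply_symm_apply T]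
    rw [subsetComposition, CompositionAsSet.toComposition_boundaries]
    simp [compositionAsSetEquiv, add_comm]
  rw [hmem, Composition.boundaries, Finset.mem_map]
  simp [Composition.boundary, Fin.exists_iff, Fin.ext_iff]

theorem exists_subsetComposition_eq (c : Composition n) :
    ∃ T, subsetComposition n T = c :=
  ⟨compositionAsSetEquiv n (compositionEquiv n c), by
    rw [subsetComposition, Equiv.symm_apply_apply]
    exact (compositionEquiv n).symm_apply_apply c⟩

theorem IsMonomialSeq.prefixSet_eq {i : Fin (subsetComposition n T).length → ℕ}
    (h : IsMonomialSeq (subsetComposition n T) d i) : prefixSet n d = T := by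
  ext s
  rw [mem_prefixSet, mem_iff_exists_sizeUpTo_subsetComposition]
  exact h.exists_prefixSum_eq_iff (by lia)

theorem exists_isMonomialSeq_subsetComposition_iff :
    (∃ i, IsMonomialSeq (subsetComposition n T) d i) ↔ d.degree = n ∧ prefixSet n d = T := by
  refine ⟨fun ⟨i, hi⟩ => ⟨hi.degree_eq, hi.prefixSet_eq⟩, ?_⟩
  rintro ⟨rfl, rfl⟩
  obtain ⟨c, i, hi⟩ := exists_isMonomialSeq d
  obtain ⟨T, rfl⟩ := exists_subsetComposition_eq c
  rw [hi.prefixSet_eq]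
  exact ⟨i, hi⟩

theorem exists_prefixSet_eq (T : Finset (Fin (n - 1))) :
    ∃ d : ℕ →₀ ℕ, d.degree = n ∧ prefixSet n d = T :=
  ⟨_, exists_isMonomialSeq_subsetComposition_iff.1 ⟨Fin.val, Fin.val_strictMono, rfl⟩⟩

open Classical in
theorem monomialQSym_apply :
    monomialQSym n T d = if d.degree = n ∧ prefixSet n d = T then 1 else 0 := by
  change (Nat.card {i // IsMonomialSeq (subsetComposition n T) d i} : ℂ) = _
  simp_rw [← exists_isMonomialSeq_subsetComposition_iff]
  split_ifs with h
  · obtain ⟨i, hi⟩ := h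
    rw [Nat.card_eq_one_iff_unique.2 ⟨⟨fun a b => Subtype.ext (a.2.unique b.2)⟩, ⟨i, hi⟩⟩,
      Nat.cast_one]
  · have : IsEmpty {i // IsMonomialSeq (subsetComposition n T) d i} := ⟨fun i => h ⟨i, i.2⟩⟩
    rw [Nat.card_of_isEmpty, Nat.cast_zero]

open Classical in
theorem fundamentalQSym_apply {S : Finset (Fin (n - 1))} :
    fundamentalQSym n S d = if d.degree = n ∧ S ⊆ prefixSet n d then 1 else 0 := by
  have hsum : fundamentalQSym n S d = ∑ T with S ⊆ T, monomialQSym n T d := by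
    rw [fundamentalQSym]
    exact Finset.sum_apply d _ _
  simp only [hsum, monomialQSym_apply]
  by_cases hd : d.degree = n <;> simp [hd]

theorem sum_smul_fundamentalQSym_apply (c : Finset (Fin (n - 1)) → ℂ) :
    (∑ S, c S • fundamentalQSym n S) d =
      if d.degree = n then ∑ S ∈ (prefixSet n d).powerset, c S else 0 := by
  have hsum : (∑ S, c S • fundamentalQSym n S) d = ∑ S, c S * fundamentalQSym n S d :=
    Finset.sum_apply d _ _
  simp_rw [hsum, fundamentalQSym_apply]
  split_ifs with hd
  · simp [hd, ← Finset.sum_filter, ← Finset.filter_subset_univ]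
  · simp [hd]

theorem isFundamentalExpansion_iff {G : Type*} {Φ : G → MvPowerSeries ℕ ℂ}
    {a : Finset (Fin (n - 1)) → G → ℂ}
    (hΦ : ∀ g d, Φ g d = if d.degree = n then a (prefixSet n d) g else 0)
    {c : Finset (Fin (n - 1)) → G → ℂ} :
    IsFundamentalExpansion n Φ c ↔
      ∀ S g, c S g = ∑ T ∈ S.powerset, (-1) ^ (S.card + T.card) * a T g := by
  have hcoeff : IsFundamentalExpansion n Φ c ↔ ∀ g T, ∑ S ∈ T.powerset, c S g = a T g := by
    refine forall_congr' fun g => ⟨fun h T => ?_, fun h => funext fun d => ?_⟩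
    · obtain ⟨d, hd, rfl⟩ := exists_prefixSet_eq T
      simpa [hΦ, sum_smul_fundamentalQSym_apply (fun S => c S g), hd] using (congrFun h d).symm
    · rw [hΦ, sum_smul_fundamentalQSym_apply fun S => c S g, h]
  rw [hcoeff, forall_comm (α := Finset (Fin (n - 1)))]
  exact forall_congr' fun g => sum_powerset_eq_iff

end Coefficients

/-! ### Initial segments -/

section InitialSegments

open scoped Pointwise

variable {N : Type*} [Fintype N] {f f' : N → ℕ} {d : ℕ →₀ ℕ} {m : ℕ} {r : N → N → Prop}
  {W : Finset (N × N)}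

/-- The functions that are weakly increasing along `r` and strictly increasing along `W`. -/
def increasingFunctions {N : Type*} (r : N → N → Prop) (W : Finset (N × N)) : Set (N → ℕ) :=
  {f | (∀ u v, r u v → f u ≤ f v) ∧ ∀ p ∈ W, f p.1 < f p.2}

/-- The set of elements where `f` takes a value less than `m`. -/
def initialSegment (f : N → ℕ) (m : ℕ) : Finset N := {v | f v < m}

theorem mem_initialSegment {v : N} : v ∈ initialSegment f m ↔ f v < m := by
  simp [initialSegment]

theorem monotone_initialSegment (f : N → ℕ) : Monotone (initialSegment f) := fun m m' h v => by
  simp only [mem_initialSegment]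
  exact fun hv => hv.trans_le h

theorem eq_of_forall_initialSegment_eq (h : ∀ m, initialSegment f m = initialSegment f' m) :
    f = f' := by
  funext v
  refine eq_of_forall_lt_iff fun m => ?_
  rw [← not_le, ← not_le, not_iff_not, ← Nat.lt_succ_iff, ← Nat.lt_succ_iff,
    ← mem_initialSegment, ← mem_initialSegment, h]

theorem exists_forall_initialSegment_eq {J : ℕ → Finset N} (hJ : Monotone J) (h0 : J 0 = ∅)
    (hm : J m = Finset.univ) : ∃ f, ∀ k, initialSegment f k = J k := by
  classical
  have hex (v : N) : ∃ k, v ∈ J k := ⟨m, hm ▸ Finset.mem_univ v⟩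
  have hpos (v : N) : 0 < Nat.find (hex v) := by simp [h0]
  refine ⟨fun v => Nat.find (hex v) - 1, fun k => Finset.ext fun v => ?_⟩
  have hle : Nat.find (hex v) ≤ k ↔ v ∈ J k :=
    ⟨fun h => hJ h (Nat.find_spec (hex v)), Nat.find_min' (hex v)⟩
  rw [mem_initialSegment, ← hle]
  have := hpos v
  lia

theorem card_initialSegment (f : N → ℕ) (m : ℕ) :
    (initialSegment f m).card = prefixSum (∑ v, Finsupp.single (f v) 1) m := by
  simp only [prefixSum, Finsupp.finsetSum_apply]
  rw [Finset.sum_comm, initialSegment, Finset.card_filter]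
  simp [Finsupp.single_apply]

theorem prefixSum_injective : Function.Injective prefixSum := fun d d' h => by
  ext l
  have hsucc := congrFun h (l + 1)
  rwa [prefixSum, prefixSum, Finset.sum_range_succ, Finset.sum_range_succ, ← prefixSum,
    ← prefixSum, h, Nat.add_left_cancel_iff] at hsucc

theorem monotone_prefixSum (d : ℕ →₀ ℕ) : Monotone (prefixSum d) := fun _ _ h =>
  Finset.sum_le_sum_of_subset (Finset.range_subset_range.2 h)

theorem exists_forall_ge_prefixSum_eq_degree (d : ℕ →₀ ℕ) :
    ∃ M, ∀ m ≥ M, prefixSum d m = d.degree := by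
  obtain ⟨M, hM⟩ := d.support.exists_nat_subset_range
  exact ⟨M, fun m hm => (Finset.sum_subset (hM.trans (Finset.range_subset_range.2 hm))
    fun l _ hl => Finsupp.notMem_support_iff.1 hl).symm⟩

theorem prefixSum_le_degree (d : ℕ →₀ ℕ) (m : ℕ) : prefixSum d m ≤ d.degree := by
  obtain ⟨M, hM⟩ := exists_forall_ge_prefixSum_eq_degree d
  exact (monotone_prefixSum d (le_max_left m M)).trans_eq (hM _ (le_max_right m M))

theorem exists_forall_initialSegment_mem {C : Set (Finset N)} (hC : IsChain (· ⊆ ·) C)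
    (hd : d.degree = Fintype.card N) (hCd : ∀ m, ∃ I ∈ C, I.card = prefixSum d m) :
    ∃ f : N → ℕ, ∑ v, Finsupp.single (f v) 1 = d ∧ ∀ m, initialSegment f m ∈ C := by
  choose J hJC hJ using hCd
  have hmono : Monotone J := fun m m' h => (hC.total (hJC m) (hJC m')).elim id fun hsub =>
    (Finset.eq_of_subset_of_card_le hsub (by grind [monotone_prefixSum d h])).ge
  obtain ⟨m, hm⟩ := exists_forall_ge_prefixSum_eq_degree d
  obtain ⟨f, hf⟩ := exists_forall_initialSegment_eq hmono (Finset.card_eq_zero.1 (hJ 0))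
    ((Finset.card_eq_iff_eq_univ _).1 (by rw [hJ, hm m le_rfl, hd] : (J m).card = _))
  refine ⟨f, prefixSum_injective (funext fun k => ?_), fun k => hf k ▸ hJC k⟩
  rw [← card_initialSegment, hf, hJ]

open Classical in
/-- The nonempty proper initial segments of `f`. -/
noncomputable def segmentChain (f : N → ℕ) : Finset (Finset N) :=
  {I | I.card ∈ Finset.Ioo 0 (Fintype.card N) ∧ ∃ m, initialSegment f m = I}

theorem mem_segmentChain {I : Finset N} : I ∈ segmentChain f ↔
    I.card ∈ Finset.Ioo 0 (Fintype.card N) ∧ ∃ m, initialSegment f m = I := by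
  simp [segmentChain]

theorem initialSegment_mem_segmentChain {u v : N} (hu : f u < m) (hv : m ≤ f v) :
    initialSegment f m ∈ segmentChain f := by
  refine mem_segmentChain.2 ⟨Finset.mem_Ioo.2 ⟨?_, ?_⟩, m, rfl⟩
  · exact Finset.card_pos.2 ⟨u, mem_initialSegment.2 hu⟩
  · exact Finset.card_lt_univ_of_notMem (x := v) (by simpa [mem_initialSegment] using hv)

theorem isChain_segmentChain (f : N → ℕ) :
    IsChain (· ⊆ ·) (segmentChain f : Set (Finset N)) :=
  (monotone_initialSegment f).isChain_range.mono fun _ hI => (mem_segmentChain.1 hI).2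

theorem segmentChain_mem_faces_iff :
    segmentChain f ∈ faces r W (Finset.Ioo 0 (Fintype.card N)) ↔ f ∈ increasingFunctions r W := by
  constructor
  · rintro ⟨-, hclosed, hsep⟩
    refine ⟨fun u v huv => ?_, fun p hp => ?_⟩
    · by_contra! hvu
      have hI := (hclosed _ (initialSegment_mem_segmentChain (Nat.lt_succ_self (f v)) hvu)).2
      exact (mem_initialSegment.1 (hI u v huv (mem_initialSegment.2 (Nat.lt_succ_self _)))).not_ge
        hvu
    · obtain ⟨I, hI, hu, hv⟩ := hsep p hp
      obtain ⟨m, rfl⟩ := (mem_segmentChain.1 hI).2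
      rw [mem_initialSegment] at hu hv
      exact hu.trans_le (not_lt.1 hv)
  · rintro ⟨hr, hW⟩
    refine ⟨isChain_segmentChain f, fun I hI => ⟨(mem_segmentChain.1 hI).1, fun u v huv hv => ?_⟩,
      fun p hp => ⟨initialSegment f (f p.2), initialSegment_mem_segmentChain (hW p hp) le_rfl,
        mem_initialSegment.2 (hW p hp), fun h => (mem_initialSegment.1 h).false⟩⟩
    obtain ⟨m, rfl⟩ := (mem_segmentChain.1 hI).2
    exact mem_initialSegment.2 ((hr u v huv).trans_lt (mem_initialSegment.1 hv))

theorem eq_of_segmentChain_eq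
    (h : ∑ v, (Finsupp.single (f v) 1 : ℕ →₀ ℕ) = ∑ v, Finsupp.single (f' v) 1)
    (hF : segmentChain f = segmentChain f') : f = f' := by
  refine eq_of_forall_initialSegment_eq fun m => ?_
  have hcard : (initialSegment f m).card = (initialSegment f' m).card := by
    rw [card_initialSegment, card_initialSegment, h]
  obtain h0 | h0 := (initialSegment f m).card.eq_zero_or_pos
  · rw [Finset.card_eq_zero.1 h0, Finset.card_eq_zero.1 (hcard.symm.trans h0)]
  obtain h1 | h1 := (Finset.card_le_univ (initialSegment f m)).eq_or_lt
  · rw [(Finset.card_eq_iff_eq_univ _).1 h1, (Finset.card_eq_iff_eq_univ _).1 (hcard.symm.trans h1)]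
  have hproper := Finset.mem_Ioo.2 ⟨h0, h1⟩
  exact injOn_card_of_isChain (isChain_segmentChain f')
    (hF ▸ mem_segmentChain.2 ⟨hproper, m, rfl⟩)
    (mem_segmentChain.2 ⟨hcard ▸ hproper, m, rfl⟩) hcard

open Classical in
/-- The set of cardinalities of the members of `F`, as a subset of `[n-1]`; as in
`subsetComposition`, the element `s : Fin (n - 1)` stands for `s + 1 ∈ [n-1]`. -/
noncomputable def chainType (F : Finset (Finset N)) : Finset (Fin (Fintype.card N - 1)) :=
  {s | ∃ I ∈ F, I.card = s + 1}

theorem mem_chainType {F : Finset (Finset N)} {s : Fin (Fintype.card N - 1)} :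
    s ∈ chainType F ↔ ∃ I ∈ F, I.card = s + 1 := by
  simp [chainType]

theorem chainType_segmentChain (f : N → ℕ) :
    chainType (segmentChain f) =
      prefixSet (Fintype.card N) (∑ v, Finsupp.single (f v) 1) := by
  ext s
  simp only [mem_chainType, mem_prefixSet, ← card_initialSegment, mem_segmentChain]
  constructor
  · rintro ⟨_, ⟨-, m, rfl⟩, hs⟩
    exact ⟨m, hs⟩
  · rintro ⟨m, hm⟩
    exact ⟨_, ⟨Finset.mem_Ioo.2 (by lia), m, rfl⟩, hm⟩

theorem image_succ_chainType {F : Finset (Finset N)}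
    (hF : ∀ I ∈ F, I.card ∈ Finset.Ioo 0 (Fintype.card N)) :
    (chainType F).image (fun s => s.val + 1) = F.image Finset.card := by
  ext k
  simp only [Finset.mem_image, mem_chainType]
  constructor
  · rintro ⟨s, ⟨I, hI, hs⟩, rfl⟩
    exact ⟨I, hI, hs⟩
  · rintro ⟨I, hI, rfl⟩
    obtain ⟨h0, h1⟩ := Finset.mem_Ioo.1 (hF I hI)
    exact ⟨⟨I.card - 1, by lia⟩, ⟨I, hI, by grind⟩, by grind⟩

theorem injective_val_add_one (n : ℕ) : Function.Injective fun s : Fin n => s.val + 1 :=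
  (add_left_injective 1).comp Fin.val_injective

theorem card_chainType {F : Finset (Finset N)} (hF : IsChain (· ⊆ ·) (F : Set (Finset N)))
    (hproper : ∀ I ∈ F, I.card ∈ Finset.Ioo 0 (Fintype.card N)) :
    (chainType F).card = F.card := by
  rw [← Finset.card_image_of_injective _ (injective_val_add_one _), image_succ_chainType hproper,
    Finset.card_image_of_injOn (injOn_card_of_isChain hF)]

theorem mem_faces_image_succ_iff {F : Finset (Finset N)} {S : Finset (Fin (Fintype.card N - 1))} :
    F ∈ faces r W (S.image fun s => s.val + 1) ↔
      F ∈ faces r W (Finset.Ioo 0 (Fintype.card N)) ∧ chainType F ⊆ S := by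
  have hIoo : (S.image fun s => s.val + 1) ⊆ Finset.Ioo 0 (Fintype.card N) :=
    Finset.image_subset_iff.2 fun s _ => Finset.mem_Ioo.2 (by lia)
  constructor
  · rintro ⟨hchain, hF, hsep⟩
    have hproper : ∀ I ∈ F, I.card ∈ Finset.Ioo 0 (Fintype.card N) := fun I hI => hIoo (hF I hI).1
    refine ⟨⟨hchain, fun I hI => ⟨hproper I hI, (hF I hI).2⟩, hsep⟩, ?_⟩
    rw [← Finset.image_subset_image_iff (injective_val_add_one _), image_succ_chainType hproper]
    exact Finset.image_subset_iff.2 fun I hI => (hF I hI).1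
  · rintro ⟨⟨hchain, hF, hsep⟩, hS⟩
    rw [← Finset.image_subset_image_iff (injective_val_add_one _),
      image_succ_chainType fun I hI => (hF I hI).1] at hS
    exact ⟨hchain, fun I hI => ⟨hS (Finset.mem_image_of_mem _ hI), (hF I hI).2⟩, hsep⟩

theorem exists_segmentChain_eq {F : Finset (Finset N)}
    (hF : IsChain (· ⊆ ·) (F : Set (Finset N)))
    (hproper : ∀ I ∈ F, I.card ∈ Finset.Ioo 0 (Fintype.card N))
    (hd : d.degree = Fintype.card N) (hT : chainType F = prefixSet (Fintype.card N) d) :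
    ∃ f : N → ℕ, ∑ v, Finsupp.single (f v) 1 = d ∧ segmentChain f = F := by
  have hchain : IsChain (· ⊆ ·) (insert ∅ (insert Finset.univ (F : Set (Finset N)))) :=
    (hF.insert fun I _ _ => Or.inr (Finset.subset_univ _)).insert
      fun I _ _ => Or.inl (Finset.empty_subset _)
  obtain ⟨f, rfl, hf⟩ := exists_forall_initialSegment_mem hchain hd fun m => by
    obtain h0 | h0 := (prefixSum d m).eq_zero_or_pos
    · exact ⟨∅, by simp, by simp [h0]⟩
    obtain h1 | h1 := (prefixSum_le_degree d m).eq_or_lt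
    · exact ⟨Finset.univ, by simp, by simp [h1, hd]⟩
    have hs : (⟨prefixSum d m - 1, by lia⟩ : Fin (Fintype.card N - 1)) ∈ chainType F :=
      hT ▸ mem_prefixSet.2 ⟨m, by grind⟩
    obtain ⟨I, hI, hIm⟩ := mem_chainType.1 hs
    exact ⟨I, by simp [hI], by grind⟩
  have hsub : segmentChain f ⊆ F := fun I hI => by
    obtain ⟨hI, m, rfl⟩ := mem_segmentChain.1 hI
    obtain h | h | h := hf m
    · simp [h] at hI
    · simp [h] at hI
    · exact h
  refine ⟨f, rfl, Finset.eq_of_subset_of_card_le hsub ?_⟩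
  rw [← card_chainType hF hproper, hT, ← chainType_segmentChain,
    card_chainType (isChain_segmentChain f) fun I hI => (mem_segmentChain.1 hI).1]

section Action

variable [DecidableEq N] {G : Type*} [Group G] [MulAction G N]

theorem smul_segmentChain (f : N → ℕ) (g : G) :
    g • segmentChain f = segmentChain fun v => f (g⁻¹ • v) := by
  have hsmul (m : ℕ) : g • initialSegment f m = initialSegment (fun v => f (g⁻¹ • v)) m := by
    ext v
    rw [← Finset.inv_smul_mem_iff, mem_initialSegment, mem_initialSegment]
  ext I
  rw [← Finset.inv_smul_mem_iff, mem_segmentChain, mem_segmentChain, Finset.card_smul_finset]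
  simp only [← hsmul, eq_inv_smul_iff]

/-- The number of chains of type `T` fixed by `g`. -/
noncomputable def fixedChainCount (G : Type*) [Group G] [MulAction G N] (r : N → N → Prop)
    (W : Finset (N × N)) (T : Finset (Fin (Fintype.card N - 1))) (g : G) : ℂ :=
  (Nat.card {F : Finset (Finset N) // F ∈ faces r W (Finset.Ioo 0 (Fintype.card N)) ∧
    chainType F = T ∧ g • F = F} : ℂ)

theorem bijOn_segmentChain (r : N → N → Prop) (W : Finset (N × N)) (g : G)
    (hd : d.degree = Fintype.card N) : Set.BijOn segmentChain
      {f | f ∈ fixedFunctions (increasingFunctions r W) g ∧ ∑ v, Finsupp.single (f v) 1 = d}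
      {F | F ∈ faces r W (Finset.Ioo 0 (Fintype.card N)) ∧
        chainType F = prefixSet (Fintype.card N) d ∧ g • F = F} := by
  refine ⟨?_, fun f hf f' hf' => eq_of_segmentChain_eq (hf.2.trans hf'.2.symm), ?_⟩
  · rintro f ⟨⟨hf, hfg⟩, rfl⟩
    exact ⟨segmentChain_mem_faces_iff.2 hf, chainType_segmentChain f,
      by rw [smul_segmentChain, hfg]⟩
  · rintro F ⟨hF, hT, hg⟩
    obtain ⟨f, hfd, rfl⟩ := exists_segmentChain_eq hF.1 (fun I hI => (hF.2.1 I hI).1) hd hT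
    refine ⟨f, ⟨⟨segmentChain_mem_faces_iff.1 hF, ?_⟩, hfd⟩, rfl⟩
    refine eq_of_segmentChain_eq ?_ ((smul_segmentChain f g).symm.trans hg)
    exact Equiv.sum_comp (MulAction.toPerm g⁻¹) fun v => Finsupp.single (f v) 1

theorem genFun_fixedFunctions_apply (r : N → N → Prop) (W : Finset (N × N)) (g : G)
    (d : ℕ →₀ ℕ) : genFun (fixedFunctions (increasingFunctions r W) g) d =
      if d.degree = Fintype.card N then
        fixedChainCount G r W (prefixSet (Fintype.card N) d) g else 0 := by
  rw [genFun]
  split_ifs with hd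
  · rw [fixedChainCount, Nat.cast_inj]
    exact Nat.card_congr (bijOn_segmentChain r W g hd).equiv
  · have : IsEmpty {f : N → ℕ // f ∈ fixedFunctions (increasingFunctions r W) g ∧
        ∑ v, Finsupp.single (f v) 1 = d} := ⟨fun f => hd (by simp [← f.2.2, map_sum])⟩
    rw [Nat.card_of_isEmpty, Nat.cast_zero]

open Classical in
theorem sum_fixedChainCount (r : N → N → Prop) (W : Finset (N × N))
    (S : Finset (Fin (Fintype.card N - 1))) (g : G) :
    ∑ T ∈ S.powerset, (-1) ^ (S.card + T.card) * fixedChainCount G r W T g =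
      ∑ F : Finset (Finset N) with F ∈ faces r W (S.image fun s => s.val + 1) ∧ g • F = F,
        (-1) ^ (S.card + F.card) := by
  simp only [mem_faces_image_succ_iff]
  rw [← Finset.sum_fiberwise_of_maps_to (t := S.powerset) (g := chainType)
    fun F hF => Finset.mem_powerset.2 (Finset.mem_filter.1 hF).2.1.2]
  refine Finset.sum_congr rfl fun T hT => ?_
  rw [Finset.filter_filter, fixedChainCount, Nat.card_eq_fintype_card, Fintype.card_subtype,
    mul_comm, ← nsmul_eq_mul, ← Finset.sum_const]
  refine Finset.sum_congr (Finset.ext fun F => ?_) fun F hF => ?_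
  · simp only [Finset.mem_filter_univ]
    grind
  · obtain ⟨⟨⟨⟨hchain, hclosed, -⟩, -⟩, -⟩, rfl⟩ := (Finset.mem_filter_univ F).1 hF
    rw [card_chainType hchain fun I hI => (hclosed I hI).1]

end Action

end InitialSegments

/-! ### Coefficients of chromatic quasisymmetric functions -/

namespace MixedGraph

variable {V : Type*} [Fintype V] {Γ : MixedGraph V}

theorem weakColorings_eq_increasingFunctions
    (hΓ : ∀ u v, Γ.undirected.Adj u v → Γ.directed.Adj u v ∨ Γ.directed.Adj v u) :
    Γ.weakColorings = increasingFunctions Γ.directed.Adj Γ.strictPairs := by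
  ext f
  refine ⟨fun ⟨hne, hle⟩ => ⟨hle, fun p hp => ?_⟩, fun ⟨hle, hlt⟩ => ⟨fun u v huv => ?_, hle⟩⟩
  · obtain ⟨hdir, hundir⟩ := mem_strictPairs.1 hp
    exact (hle _ _ hdir).lt_of_ne (hne _ _ hundir)
  · obtain h | h := hΓ u v huv
    · exact (hlt (u, v) (mem_strictPairs.2 ⟨h, huv⟩)).ne
    · exact (hlt (v, u) (mem_strictPairs.2 ⟨h, huv.symm⟩)).ne'

variable {G : Type*} [Group G] [MulAction G V] [DecidableEq V]
  {S : Finset (Fin (Fintype.card V - 1))}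

/-- The coefficient of `F_{S,n}` in the chromatic quasisymmetric function of `Γ`, provided that
every undirected edge of `Γ` is parallel to a directed one. -/
noncomputable def fundamentalCoeff (Γ : MixedGraph V) (G : Type*) [Group G] [MulAction G V]
    (S : Finset (Fin (Fintype.card V - 1))) (g : G) : ℂ :=
  ∑ T ∈ S.powerset,
    (-1) ^ (S.card + T.card) * fixedChainCount G Γ.directed.Adj Γ.strictPairs T g

theorem isFundamentalExpansion_chromaticQSym_iff
    (hΓ : ∀ u v, Γ.undirected.Adj u v → Γ.directed.Adj u v ∨ Γ.directed.Adj v u)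
    {c : Finset (Fin (Fintype.card V - 1)) → G → ℂ} :
    IsFundamentalExpansion (Fintype.card V) (Γ.chromaticQSym G) c ↔ c = Γ.fundamentalCoeff G := by
  simp only [funext_iff]
  refine isFundamentalExpansion_iff fun g d => ?_
  rw [chromaticQSym, weakColorings_eq_increasingFunctions hΓ, genFun_fixedFunctions_apply]

open scoped Pointwise in
theorem isEffectiveCharacter_fundamentalCoeff
    (hΓ : Std.Antisymm (Relation.ReflTransGen Γ.directed.Adj))
    (hG : ∀ g : G, Γ.IsAutomorphism (MulAction.toPerm g)) (hS : S.card ≤ Γ.m) :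
    IsEffectiveCharacter (Γ.fundamentalCoeff G S) := by
  classical
  set X := faces Γ.directed.Adj Γ.strictPairs (S.image fun s => s.val + 1)
  have hcoeff : Γ.fundamentalCoeff G S = fun g => ∑ F with F ∈ X ∧ g • F = F,
      (-1) ^ (S.card + F.card) :=
    funext (sum_fixedChainCount Γ.directed.Adj Γ.strictPairs S)
  have hinvariant : ∀ (g : G), ∀ F ∈ X, g • F ∈ X := fun g F => smul_mem_faces
    (fun g u v => ((hG g).2 u v).2)
    (fun g p hp => mem_strictPairs.2 ((mem_strictPairs.1 hp).imp ((hG g).2 _ _).2 ((hG g).1 _ _).2))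
    g
  rw [hcoeff]
  refine isEffectiveCharacter_sum_fixedFaces ordConnected_faces injOn_card_of_mem_faces hinvariant
    Finset.card_smul_finset (fun F hF => ?_) fun i hi => ?_
  · obtain ⟨hF, hFS⟩ := mem_faces_image_succ_iff.1 hF
    rw [← card_chainType hF.1 fun I hI => (hF.2.1 I hI).1]
    exact Finset.card_le_card hFS
  · refine acyclicAt_faces (Finset.image_subset_iff.2 fun s _ => Finset.mem_Icc.2 (by lia)) _ _
      fun A hA hAi => ?_
    rw [Finset.card_image_of_injective _ (injective_val_add_one _)]
    have := card_le_numClasses_addReverse_add_card hΓ hA (by lia)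
    lia

end MixedGraph

/-! ### Descents and partitions of double posets -/

namespace DoublePoset

open Relation

variable {N : Type*} {D : DoublePoset N} {a b : N}

theorem isDescent_iff : D.IsDescent a b ↔ D.covBy₁ a b ∧ D.le₂ b a := by
  refine ⟨fun ⟨⟨_, h⟩, hcov⟩ => ⟨hcov, @le_of_lt _ D.ord₂.toPreorder _ _ h⟩, fun ⟨hcov, hle⟩ =>
    ⟨⟨hcov.1, @lt_of_le_of_ne _ D.ord₂ _ _ hle ?_⟩, hcov⟩⟩
  exact (@ne_of_lt _ D.ord₁.toPreorder _ _ hcov.1).symm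

theorem mixedGraph_undirected_adj :
    D.mixedGraph.undirected.Adj a b ↔ D.IsDescent a b ∨ D.IsDescent b a := by
  rw [isDescent_iff, isDescent_iff]
  refine (SimpleGraph.fromRel_adj _ _ _).trans (and_iff_right_of_imp ?_)
  rintro (⟨⟨h, -⟩, -⟩ | ⟨⟨h, -⟩, -⟩)
  · exact @ne_of_lt _ D.ord₁.toPreorder _ _ h
  · exact (@ne_of_lt _ D.ord₁.toPreorder _ _ h).symm

section Action

variable {G : Type*} [Group G] [MulAction G N]

theorem ActsOn.le₁_iff (hG : ActsOn G D) (g : G) : D.le₁ (g • a) (g • b) ↔ D.le₁ a b :=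
  ⟨fun h => by simpa using (hG g⁻¹ _ _).1 h, (hG g a b).1⟩

theorem ActsOn.le₂_iff (hG : ActsOn G D) (g : G) : D.le₂ (g • a) (g • b) ↔ D.le₂ a b :=
  ⟨fun h => by simpa using (hG g⁻¹ _ _).2 h, (hG g a b).2⟩

theorem ActsOn.lt₁_iff (hG : ActsOn G D) (g : G) : D.lt₁ (g • a) (g • b) ↔ D.lt₁ a b := by
  let _ := D.ord₁
  exact lt_iff_lt_of_le_iff_le' (hG.le₁_iff g) (hG.le₁_iff g)

theorem ActsOn.covBy₁_iff (hG : ActsOn G D) (g : G) :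
    D.covBy₁ (g • a) (g • b) ↔ D.covBy₁ a b := by
  refine and_congr (hG.lt₁_iff g) ?_
  rw [(MulAction.surjective g).forall]
  simp only [hG.lt₁_iff]

theorem ActsOn.isAutomorphism (hG : ActsOn G D) (g : G) :
    D.mixedGraph.IsAutomorphism (MulAction.toPerm g) := by
  refine ⟨fun u v => ?_, fun u v => hG.covBy₁_iff g⟩
  simp only [mixedGraph_undirected_adj, isDescent_iff, MulAction.toPerm_apply, hG.covBy₁_iff,
    hG.le₂_iff]

end Action

theorem le₁_of_reflTransGen_covBy₁ (h : ReflTransGen D.covBy₁ a b) : D.le₁ a b := by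
  let _ := D.ord₁
  exact ReflTransGen.trans_induction_on h (fun a => le_refl a) (fun h => h.1.le)
    fun _ _ h h' => le_trans (α := N) h h'

theorem antisymm_reflTransGen_covBy₁ (D : DoublePoset N) :
    Std.Antisymm (ReflTransGen D.covBy₁) :=
  ⟨fun _ _ hab hba => D.ord₁.le_antisymm _ _ (le₁_of_reflTransGen_covBy₁ hab)
    (le₁_of_reflTransGen_covBy₁ hba)⟩

variable [Finite N]

theorem reflTransGen_covBy₁_of_le₁ (h : D.le₁ a b) : ReflTransGen D.covBy₁ a b := by
  classical
  let _ := D.ord₁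
  let _ := Fintype.ofFinite N
  let _ := Fintype.toLocallyFiniteOrder (α := N)
  exact ReflTransGen.mono (fun a b hab => ⟨hab.1, fun c hc => hab.2 hc.1 hc.2⟩) _ _
    (le_iff_reflTransGen_covBy.1 h)

theorem InversionReducible.exists_isDescent (hD : D.InversionReducible)
    (hab : D.IsInversion a b) : ∃ u v, D.le₁ a u ∧ D.IsDescent u v ∧ D.le₁ v b := by
  let _ := D.ord₁
  induction hI : Set.Ioo a b using WellFoundedLT.induction generalizing a b with
  | _ I ih =>
    subst hI
    obtain hdescent | ⟨c, hac, hcb, hc | hc⟩ := hD a b hab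
    · exact ⟨a, b, le_refl a, hdescent, le_refl b⟩
    · obtain ⟨u, v, hau, huv, hvc⟩ := ih (Set.Ioo a c)
        ⟨Set.Ioo_subset_Ioo_right (le_of_lt hcb), fun h => (h ⟨hac, hcb⟩).2.false⟩ hc rfl
      exact ⟨u, v, hau, huv, le_trans (α := N) hvc (le_of_lt hcb)⟩
    · obtain ⟨u, v, hcu, huv, hvb⟩ := ih (Set.Ioo c b)
        ⟨Set.Ioo_subset_Ioo_left (le_of_lt hac), fun h => (h ⟨hac, hcb⟩).1.false⟩ hc rfl
      exact ⟨u, v, le_trans (α := N) (le_of_lt hac) hcu, huv, hvb⟩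

theorem InversionReducible.partitions_eq_weakColorings (hD : D.InversionReducible) :
    D.partitions = D.mixedGraph.weakColorings := by
  let _ := D.ord₁
  ext f
  refine ⟨fun ⟨hle, hlt⟩ => ⟨fun u v huv => ?_, fun u v huv => hle u v (le_of_lt huv.1)⟩,
    fun ⟨hne, hle⟩ => ?_⟩
  · obtain h | h := mixedGraph_undirected_adj.1 huv
    · exact (hlt u v h.1.1 h.1.2).ne
    · exact (hlt v u h.1.1 h.1.2).ne'
  · have hmono : ∀ a b, D.le₁ a b → f a ≤ f b := fun a b hab =>
      ReflTransGen.trans_induction_on (reflTransGen_covBy₁_of_le₁ hab) (fun _ => le_rfl)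
        (fun h => hle _ _ h) fun _ _ => le_trans
    refine ⟨hmono, fun a b hab hba => ?_⟩
    obtain ⟨u, v, hau, huv, hvb⟩ := hD.exists_isDescent ⟨hab, hba⟩
    calc f a ≤ f u := hmono a u hau
      _ < f v := (hle u v huv.2).lt_of_ne (hne u v (mixedGraph_undirected_adj.2 (Or.inl huv)))
      _ ≤ f b := hmono v b hvb

end DoublePoset

theorem mainTheorem10_general {N : Type*} [Fintype N] (D : DoublePoset N)
    (hD : D.InversionReducible) {G : Type*} [Group G] [MulAction G N]
    (hG : DoublePoset.ActsOn G D) :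
    (∀ g : G, D.mixedGraph.IsAutomorphism (MulAction.toPerm g)) ∧
    (∀ g : G, D.partitionQSym G g = D.mixedGraph.chromaticQSym G g) ∧
    ∃ c : Finset (Fin (Fintype.card N - 1)) → G → ℂ,
      (∀ c', IsFundamentalExpansion (Fintype.card N) (D.partitionQSym G) c' ↔ c' = c) ∧
      ∀ S, S.card ≤ D.mixedGraph.m → IsEffectiveCharacter (c S) := by
  classical
  have hΩ : D.partitionQSym G = D.mixedGraph.chromaticQSym G := funext fun g => by
    rw [DoublePoset.partitionQSym, hD.partitions_eq_weakColorings, MixedGraph.chromaticQSym]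
  refine ⟨hG.isAutomorphism, congrFun hΩ, D.mixedGraph.fundamentalCoeff G, fun c => ?_,
    fun S hS => ?_⟩
  · rw [hΩ]
    refine MixedGraph.isFundamentalExpansion_chromaticQSym_iff fun u v huv => ?_
    exact (DoublePoset.mixedGraph_undirected_adj.1 huv).imp And.right And.right
  · exact MixedGraph.isEffectiveCharacter_fundamentalCoeff D.antisymm_reflTransGen_covBy₁
      hG.isAutomorphism hS

theorem mainTheorem10 {N : Type*} [Fintype N] (D : DoublePoset N) (hD : D.InversionReducible)
    {G : Type*} [Group G] [Finite G] [MulAction G N] (hG : DoublePoset.ActsOn G D) :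
    (∀ g : G, D.mixedGraph.IsAutomorphism (MulAction.toPerm g)) ∧
    (∀ g : G, D.partitionQSym G g = D.mixedGraph.chromaticQSym G g) ∧
    ∃ c : Finset (Fin (Fintype.card N - 1)) → G → ℂ,
      (∀ c', IsFundamentalExpansion (Fintype.card N) (D.partitionQSym G) c' ↔ c' = c) ∧
      ∀ S, S.card ≤ D.mixedGraph.m → IsEffectiveCharacter (c S) :=
  mainTheorem10_general D hD hG
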